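/- Let $R\in\mathbb{C}(v)$ be a rational function. A solution of \[ \frac{du}{dz}=R(u) \tag{$*$} \] is a holomorphic function $u$ on a domain (nonempty connected open set) $U\subseteq\mathbb{C}$, none of whose values is a pole of $R$, with $u'(z)=R(u(z))$ for all $z\in U$. Its maximal analytic extension is the collection of all germs of analytic functions that are obtained from $u$ by analytic continuation along paths in $\mathbb{C}$ starting in $U$; it is called finitely-valued if for every $z\in\mathbb{C}$ the germs at $z$ belonging to it take only finitely many values at $z$. The maximal analytic extension of every solution of $(*)$ is finitely-valued if and only if one of the following holds: (1) $R\equiv 0$; or (2) at every zero of $R$ in $\mathbb{C}$, the residue of $1/R$ is zero; or (3) $1/R$ has the form \[ \frac{1}{R(v)}=\xi\sum_{j=1}^n\frac{\beta_j}{v-a_j} \] for some integer $n>0$, some $\xi\in\mathbb{C}\setminus\{0\}$, and some $a_j\in\mathbb{C}$ and $\beta_j\in\mathbb{Q}$, $j\in\{1,\ldots,n\}$. -/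

import Mathlib

open Filter Topology

/-- `u` is a (holomorphic) solution of `du/dz = R(u)` on the domain (nonempty connected open set)
`U`: at each point of `U` the value of `u` is not a pole of `R`, and `u` is complex differentiable
with derivative `R(u)`. -/
structure IsRatODESolution (R : RatFunc ℂ) (U : Set ℂ) (u : ℂ → ℂ) : Prop where
  isOpen : IsOpen U
  isConnected : IsConnected U
  denom_ne_zero : ∀ z ∈ U, R.denom.eval (u z) ≠ 0
  hasDerivAt : ∀ z ∈ U, HasDerivAt u (R.eval (RingHom.id ℂ) (u z)) z

/-- The family of function elements `f t` (centred at `γ t`) is an analytic continuation of `u`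
along the path `γ`: it starts from `u`, each `f t` is analytic at `γ t`, and for `s` close to `t`
the elements `f s` and `f t` agree near `γ s`. -/
structure IsAnalyticContinuationAlong (u : ℂ → ℂ) {z₀ z₁ : ℂ} (γ : Path z₀ z₁)
    (f : unitInterval → ℂ → ℂ) : Prop where
  start : f 0 =ᶠ[𝓝 (γ 0)] u
  analyticAt : ∀ t, AnalyticAt ℂ (f t) (γ t)
  compatible : ∀ t, ∀ᶠ s in 𝓝 t, f s =ᶠ[𝓝 (γ s)] f t

/-- The maximal analytic extension (complete analytic function) of `u`, an analytic function on the
domain `U`, given by its fibres: the set of all germs at `z` that are obtained from `u` by analytic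
continuation along some path in `ℂ` from a point of `U` to `z`. -/
def maximalAnalyticExtension (U : Set ℂ) (u : ℂ → ℂ) (z : ℂ) : Set (Germ (𝓝 z) ℂ) :=
  {g | ∃ z₀ ∈ U, ∃ (γ : Path z₀ z) (f : unitInterval → ℂ → ℂ),
    IsAnalyticContinuationAlong u γ f ∧ g = (f 1 : Germ (𝓝 z) ℂ)}

/-- The maximal analytic extension of `u` takes only finitely many values at each point `z`. -/
def IsFinitelyValued (U : Set ℂ) (u : ℂ → ℂ) : Prop :=
  ∀ z : ℂ, (Germ.value '' maximalAnalyticExtension U u z).Finite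

/-- The residue of the rational function `f` at `a`: the coefficient of `(v - a)⁻¹` in the Laurent
expansion of `f` about `a`. -/
noncomputable def ratResidue (f : RatFunc ℂ) (a : ℂ) : ℂ :=
  ((RatFunc.laurent a f : RatFunc ℂ) : LaurentSeries ℂ).coeff (-1)

/-!
Write `S = 1 / R`. The equation says that `S(u) du = dz`, so that `u` inverts the multivalued
primitive `F = ∫ S(v) dv`, whose branches at one point differ by periods, the integrals of `S`
along loops. A value `v` is taken at `z` by the continuation of `u` whenever some branch of `F`
takes the value `z` at `v`.

*Finitely-valued cases.* If `S` has no residues then `F` is a rational function, and if the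
residues of `S` are commensurable and `S` is a sum of simple fractions then `exp (κ F)` is a
rational function for some `κ ≠ 0`. In both cases there is a nonconstant rational function `A / B`
such that `A(u) / B(u)` extends to an entire function `w`, and the relation `A(u) = w B(u)`
persists under analytic continuation (`IsAnalyticContinuationAlong.polynomial_relation`). This
leaves finitely many values at each point (`IsRatODESolution.isFinitelyValued_of_integral`).

*Converse.* Suppose that all solutions are finitely-valued and that `S` has a nonzero residue. The
continuation of solutions is organized by transit times (`IsTransitTime`): the integrals of `S`
along paths from `v` to `v'` are differences `z' - z` of points at which a solution takes the
values `v` and `v'`. The periods form a group (`periods`), which contains `2πi` times every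
residue (`IsLocalModel.residue_mem_periods`) and so is nontrivial. If the congruence `F ≡ c`
modulo periods has infinitely many solutions near a puncture, that is a pole of `S` or infinity,
then some continuation has infinitely many values at one point
(`IsLocalModel.not_infinite_fiber`). This is used twice.

* If `S(v) dv` has a pole of order at least two at a puncture, then `exp (κ F)` is single-valued
  near it for a suitable `κ = 2πi / p` with a period `p`, and has an essential singularity there,
  since its logarithmic derivative does not have a simple pole. The Casorati–Weierstrass theorem
  together with the Baire category theorem gives a value that is taken infinitely often
  (`exists_infinite_fiber`). At infinity this excludes a polynomial part of `S`, and it leaves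
  simple poles only (`IsLocalModel.degree_le_zero`).
* At a simple pole with residue `ρ ≠ 0`, `E = exp (F / ρ)` is a local coordinate vanishing at the
  pole, and a period `l` multiplies `E` by `exp (l / ρ)`. Unless this is a root of unity, there
  are infinitely many points near the pole at which `F` takes values in one class modulo periods
  (`IsLocalModel.exists_rat_of_mem_periods`). Hence all residues are rational multiples of `ρ`.
-/

/-! ### Evaluation of rational functions and partial fractions -/

/-- The rational function `f` is regular at `v` and takes the value `y` there. -/
def RatFunc.IsEval (v : ℂ) (f : RatFunc ℂ) (y : ℂ) : Prop :=
  ∃ a b : Polynomial ℂ, b.eval v ≠ 0 ∧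
    f = algebraMap (Polynomial ℂ) (RatFunc ℂ) a / algebraMap (Polynomial ℂ) (RatFunc ℂ) b ∧
    y = a.eval v / b.eval v

namespace RatFunc.IsEval

variable {v y y' : ℂ} {f f' : RatFunc ℂ}

theorem algebraMap_ne_zero {b : Polynomial ℂ} (hb : b.eval v ≠ 0) :
    algebraMap (Polynomial ℂ) (RatFunc ℂ) b ≠ 0 := by
  rw [Ne, FaithfulSMul.algebraMap_eq_zero_iff]
  rintro rfl
  simp at hb

theorem unique (h : IsEval v f y) (h' : IsEval v f y') : y = y' := by
  obtain ⟨a, b, hb, hf, rfl⟩ := h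
  obtain ⟨a', b', hb', hf', rfl⟩ := h'
  rw [hf, div_eq_div_iff (algebraMap_ne_zero hb) (algebraMap_ne_zero hb'), ← map_mul, ← map_mul,
    (FaithfulSMul.algebraMap_injective (Polynomial ℂ) (RatFunc ℂ)).eq_iff] at hf'
  rw [div_eq_div_iff hb hb', ← Polynomial.eval_mul, hf', Polynomial.eval_mul]

theorem of_polynomial (p : Polynomial ℂ) :
    IsEval v (algebraMap (Polynomial ℂ) (RatFunc ℂ) p) (p.eval v) :=
  ⟨p, 1, by simp, by simp, by simp⟩

theorem C (c : ℂ) : IsEval v (RatFunc.C c) c := by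
  simpa using of_polynomial (v := v) (Polynomial.C c)

theorem add (h : IsEval v f y) (h' : IsEval v f' y') : IsEval v (f + f') (y + y') := by
  obtain ⟨a, b, hb, rfl, rfl⟩ := h
  obtain ⟨a', b', hb', rfl, rfl⟩ := h'
  refine ⟨a * b' + b * a', b * b', by simp [hb, hb'], ?_, ?_⟩
  · rw [div_add_div _ _ (algebraMap_ne_zero hb) (algebraMap_ne_zero hb')]; simp
  · rw [div_add_div _ _ hb hb']; simp

theorem mul (h : IsEval v f y) (h' : IsEval v f' y') : IsEval v (f * f') (y * y') := by
  obtain ⟨a, b, hb, rfl, rfl⟩ := h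
  obtain ⟨a', b', hb', rfl, rfl⟩ := h'
  refine ⟨a * a', b * b', by simp [hb, hb'], ?_, ?_⟩
  · rw [div_mul_div_comm]; simp
  · rw [div_mul_div_comm]; simp

theorem sum {ι : Type*} (s : Finset ι) {g : ι → RatFunc ℂ} {x : ι → ℂ}
    (h : ∀ i ∈ s, IsEval v (g i) (x i)) : IsEval v (∑ i ∈ s, g i) (∑ i ∈ s, x i) := by
  classical
  induction s using Finset.induction_on with
  | empty => simpa using C (v := v) 0
  | insert i s hi ih =>
    rw [Finset.sum_insert hi, Finset.sum_insert hi]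
    exact (h i (by simp)).add (ih fun j hj => h j (by simp [hj]))

theorem inv_X_sub_C {a : ℂ} (ha : v ≠ a) : IsEval v (RatFunc.X - RatFunc.C a)⁻¹ (v - a)⁻¹ :=
  ⟨1, Polynomial.X - Polynomial.C a, by simpa [sub_eq_zero] using ha, by simp, by simp⟩

theorem aeval (h : IsEval v f y) (q : Polynomial ℂ) :
    IsEval v (Polynomial.aeval f q) (q.eval y) := by
  induction q using Polynomial.induction_on with
  | C c => simpa [RatFunc.algebraMap_eq_C] using C (v := v) c
  | add p q hp hq => simpa using hp.add hq
  | monomial n c ih =>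
    rw [pow_succ, ← mul_assoc, map_mul, Polynomial.eval_mul]
    simpa using ih.mul h

/-- The value of the reciprocal `1 / f` off the zeros of `f`. -/
theorem inv_of_num_ne_zero (hv : f.num.eval v ≠ 0) :
    IsEval v f⁻¹ (f.denom.eval v / f.num.eval v) :=
  ⟨f.denom, f.num, hv, by rw [← RatFunc.num_div_denom f, inv_div, RatFunc.num_div_denom f], rfl⟩

end RatFunc.IsEval

/-- The value at `(p, Q)` is the partial fraction sum `p + ∑ₐ xₐ Qₐ(xₐ)` with `xₐ = 1 / (X - a)`:
the coefficient of `X ^ k` in `Qₐ` is the coefficient of `(X - a) ^ (-(k + 1))` in the sum. -/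
noncomputable def partialFractionSum (p : Polynomial ℂ) (Q : ℂ →₀ Polynomial ℂ) : RatFunc ℂ :=
  algebraMap (Polynomial ℂ) (RatFunc ℂ) p + Q.sum fun a q =>
    (RatFunc.X - RatFunc.C a)⁻¹ * Polynomial.aeval (RatFunc.X - RatFunc.C a)⁻¹ q

theorem partialFractionSum_add (p p' : Polynomial ℂ) (Q Q' : ℂ →₀ Polynomial ℂ) :
    partialFractionSum (p + p') (Q + Q') = partialFractionSum p Q + partialFractionSum p' Q' := by
  classical
  unfold partialFractionSum
  rw [Finsupp.sum_add_index' (by simp) (by simp [mul_add]), map_add]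
  ring

theorem partialFractionSum_C_mul (c : ℂ) (p : Polynomial ℂ) (Q : ℂ →₀ Polynomial ℂ) :
    partialFractionSum (c • p) (c • Q) = RatFunc.C c * partialFractionSum p Q := by
  unfold partialFractionSum
  rw [Finsupp.sum_smul_index' (by simp), mul_add, Finsupp.mul_sum]
  congr 1
  · simp [Polynomial.smul_eq_C_mul]
  · refine Finsupp.sum_congr fun a _ => ?_
    rw [map_smul, RatFunc.smul_eq_C_mul]
    ring

theorem partialFractionSum_zero_right (p : Polynomial ℂ) :
    partialFractionSum p 0 = algebraMap (Polynomial ℂ) (RatFunc ℂ) p := by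
  simp [partialFractionSum]

theorem partialFractionSum_single (a : ℂ) (q : Polynomial ℂ) :
    partialFractionSum 0 (Finsupp.single a q) =
      (RatFunc.X - RatFunc.C a)⁻¹ * Polynomial.aeval (RatFunc.X - RatFunc.C a)⁻¹ q := by
  simp [partialFractionSum]

theorem RatFunc.X_sub_C_ne_zero (a : ℂ) : (RatFunc.X - RatFunc.C a : RatFunc ℂ) ≠ 0 := by
  rw [← RatFunc.algebraMap_X, ← RatFunc.algebraMap_C, ← map_sub, Ne,
    FaithfulSMul.algebraMap_eq_zero_iff]
  exact Polynomial.X_sub_C_ne_zero a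

/-- The rational functions that have a partial fraction expansion. -/
def HasPartialFractions (f : RatFunc ℂ) : Prop :=
  ∃ p Q, f = partialFractionSum p Q

namespace HasPartialFractions

variable {f f' : RatFunc ℂ}

theorem add (h : HasPartialFractions f) (h' : HasPartialFractions f') :
    HasPartialFractions (f + f') := by
  obtain ⟨p, Q, rfl⟩ := h
  obtain ⟨p', Q', rfl⟩ := h'
  exact ⟨_, _, (partialFractionSum_add ..).symm⟩

theorem C_mul (c : ℂ) (h : HasPartialFractions f) : HasPartialFractions (RatFunc.C c * f) := by
  obtain ⟨p, Q, rfl⟩ := h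
  exact ⟨_, _, (partialFractionSum_C_mul ..).symm⟩

theorem sum {ι : Type*} (s : Finset ι) {g : ι → RatFunc ℂ}
    (h : ∀ i ∈ s, HasPartialFractions (g i)) : HasPartialFractions (∑ i ∈ s, g i) :=
  Finset.sum_induction _ _ (fun _ _ => add) ⟨0, 0, by simp [partialFractionSum]⟩ h

theorem of_polynomial (p : Polynomial ℂ) :
    HasPartialFractions (algebraMap (Polynomial ℂ) (RatFunc ℂ) p) :=
  ⟨p, 0, (partialFractionSum_zero_right p).symm⟩

theorem inv_pow_succ (a : ℂ) (k : ℕ) :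
    HasPartialFractions ((RatFunc.X - RatFunc.C a)⁻¹ ^ (k + 1)) :=
  ⟨0, Finsupp.single a (Polynomial.X ^ k), by
    rw [partialFractionSum_single, map_pow, Polynomial.aeval_X, pow_succ']⟩

theorem inv_mul_inv_pow (a b : ℂ) (k : ℕ) : HasPartialFractions
    ((RatFunc.X - RatFunc.C b)⁻¹ * (RatFunc.X - RatFunc.C a)⁻¹ ^ (k + 1)) := by
  rcases eq_or_ne a b with rfl | hab
  · rw [← pow_succ']
    exact inv_pow_succ a _
  have hC : (RatFunc.C (a - b) : RatFunc ℂ) ≠ 0 := by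
    rw [Ne, map_eq_zero]; exact sub_ne_zero.2 hab
  -- the resolvent identity lowers the exponent of `1 / (X - a)`
  have key : (RatFunc.X - RatFunc.C b)⁻¹ * (RatFunc.X - RatFunc.C a)⁻¹ =
      RatFunc.C (a - b)⁻¹ * ((RatFunc.X - RatFunc.C a)⁻¹ +
        RatFunc.C (-1) * (RatFunc.X - RatFunc.C b)⁻¹) := by
    have h1 := RatFunc.X_sub_C_ne_zero a
    have h2 := RatFunc.X_sub_C_ne_zero b
    rw [map_inv₀]
    field_simp
    simp
  induction k with
  | zero =>
    rw [zero_add, pow_one, key]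
    exact C_mul _ (by simpa using (inv_pow_succ a 0).add (C_mul (-1) (inv_pow_succ b 0)))
  | succ k ih =>
    rw [pow_succ', ← mul_assoc, key, mul_assoc, add_mul, ← pow_succ', mul_assoc]
    exact C_mul _ ((inv_pow_succ a _).add (C_mul _ ih))

theorem inv_X_sub_C_mul (b : ℂ) (h : HasPartialFractions f) :
    HasPartialFractions ((RatFunc.X - RatFunc.C b)⁻¹ * f) := by
  obtain ⟨p, Q, rfl⟩ := h
  rw [partialFractionSum, mul_add]
  refine add ?_ ?_
  · have : (RatFunc.X - RatFunc.C b)⁻¹ * algebraMap (Polynomial ℂ) (RatFunc ℂ) p =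
        algebraMap (Polynomial ℂ) (RatFunc ℂ) (p /ₘ (Polynomial.X - Polynomial.C b)) +
          RatFunc.C (p.eval b) * (RatFunc.X - RatFunc.C b)⁻¹ ^ (0 + 1) := by
      have h1 := RatFunc.X_sub_C_ne_zero b
      conv_lhs => rw [← Polynomial.modByMonic_add_div p (Polynomial.X - Polynomial.C b),
        Polynomial.modByMonic_X_sub_C_eq_C_eval]
      simp only [map_add, map_mul, map_sub, RatFunc.algebraMap_X, RatFunc.algebraMap_C, zero_add,
        pow_one]
      field_simp
      ring
    rw [this]
    exact (of_polynomial _).add (C_mul _ (inv_pow_succ b 0))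
  · rw [Finsupp.mul_sum]
    refine sum _ fun a _ => ?_
    simp only [Polynomial.aeval_eq_sum_range]
    rw [Finset.mul_sum, Finset.mul_sum]
    refine sum _ fun k _ => ?_
    rw [RatFunc.smul_eq_C_mul, show ∀ x y z w : RatFunc ℂ, x * (y * (z * w)) = z * (x * (y * w)) by
      intros; ring, ← pow_succ']
    exact C_mul _ (inv_mul_inv_pow a b k)

end HasPartialFractions

/-- Every complex rational function has a partial fraction expansion. -/
theorem RatFunc.hasPartialFractions (f : RatFunc ℂ) : HasPartialFractions f := by
  have key : ∀ (s : Multiset ℂ) (p : Polynomial ℂ), HasPartialFractions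
      ((s.map fun a => (RatFunc.X - RatFunc.C a)⁻¹).prod *
        algebraMap (Polynomial ℂ) (RatFunc ℂ) p) := by
    intro s p
    induction s using Multiset.induction_on with
    | empty => simpa using HasPartialFractions.of_polynomial p
    | cons a s ih =>
      rw [Multiset.map_cons, Multiset.prod_cons, mul_assoc]
      exact ih.inv_X_sub_C_mul a
  have hs := (IsAlgClosed.splits f.denom).eq_prod_roots_of_monic (RatFunc.monic_denom f)
  have h2 : (algebraMap (Polynomial ℂ) (RatFunc ℂ) f.denom)⁻¹ =
      (f.denom.roots.map fun a => (RatFunc.X - RatFunc.C a)⁻¹).prod := by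
    conv_lhs => rw [hs]
    rw [map_multiset_prod, Multiset.map_map, Multiset.prod_map_inv]
    simp [Function.comp_def]
  rw [← RatFunc.num_div_denom f, div_eq_inv_mul, h2]
  exact key _ _

/-! ### Residues -/

theorem ratResidue_add (f g : RatFunc ℂ) (a : ℂ) :
    ratResidue (f + g) a = ratResidue f a + ratResidue g a := by
  simp [ratResidue]

theorem ratResidue_sum {ι : Type*} (s : Finset ι) (g : ι → RatFunc ℂ) (a : ℂ) :
    ratResidue (∑ i ∈ s, g i) a = ∑ i ∈ s, ratResidue (g i) a := by
  simp [ratResidue, HahnSeries.coeff_sum]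

theorem algebraMap_laurentSeries_eq (r : Polynomial ℂ) :
    algebraMap (Polynomial ℂ) (LaurentSeries ℂ) r = ((r : PowerSeries ℂ) : LaurentSeries ℂ) := by
  rw [RatFunc.coe_coe]
  simp [RatFunc.coePolynomial, ← IsScalarTower.algebraMap_apply]

/-- A rational function has residue zero wherever it is regular. -/
theorem ratResidue_eq_zero_of_isEval {a y : ℂ} {f : RatFunc ℂ} (h : RatFunc.IsEval a f y) :
    ratResidue f a = 0 := by
  obtain ⟨p, q, hq, rfl, -⟩ := h
  have hq' : PowerSeries.constantCoeff
      ((Polynomial.taylor a q : Polynomial ℂ) : PowerSeries ℂ) ≠ 0 := by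
    rw [← PowerSeries.coeff_zero_eq_constantCoeff_apply, Polynomial.coeff_coe,
      Polynomial.taylor_coeff_zero]
    exact hq
  set P : PowerSeries ℂ := ((Polynomial.taylor a p : Polynomial ℂ) : PowerSeries ℂ)
  set T : PowerSeries ℂ := ((Polynomial.taylor a q : Polynomial ℂ) : PowerSeries ℂ) with hT
  have h0 : (T : LaurentSeries ℂ) ≠ 0 := by
    intro h
    have : T = 0 := HahnSeries.ofPowerSeries_injective (by rw [h, map_zero])
    rw [this, map_zero] at hq'
    exact hq' rfl
  have key : ((RatFunc.laurent a (algebraMap (Polynomial ℂ) (RatFunc ℂ) p /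
      algebraMap (Polynomial ℂ) (RatFunc ℂ) q) : RatFunc ℂ) : LaurentSeries ℂ) =
      ((P * T⁻¹ : PowerSeries ℂ) : LaurentSeries ℂ) := by
    rw [RatFunc.laurent_div, RatFunc.algebraMap_apply_div, algebraMap_laurentSeries_eq,
      algebraMap_laurentSeries_eq, div_eq_iff h0, ← PowerSeries.coe_mul, mul_assoc,
      PowerSeries.inv_mul_cancel _ hq', mul_one]
  rw [ratResidue, key, PowerSeries.coeff_coe]
  simp

theorem ratResidue_inv_mul_aeval (a : ℂ) (q : Polynomial ℂ) :
    ratResidue ((RatFunc.X - RatFunc.C a)⁻¹ * Polynomial.aeval (RatFunc.X - RatFunc.C a)⁻¹ q) a =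
      q.coeff 0 := by
  have hX : ((RatFunc.laurent a (RatFunc.X - RatFunc.C a)⁻¹ : RatFunc ℂ) : LaurentSeries ℂ) =
      HahnSeries.single (-1) 1 := by
    rw [map_inv₀, map_sub, RatFunc.laurent_X, RatFunc.laurent_C, add_sub_cancel_right, map_inv₀,
      RatFunc.coe_X, HahnSeries.inv_single, inv_one]
  have hpow : ∀ k : ℕ, (HahnSeries.single (-1 : ℤ) (1 : ℂ)) ^ k =
      HahnSeries.single (-(k : ℤ)) 1 := by
    intro k
    simp
  have hC : ∀ c : ℂ, ((RatFunc.C c : RatFunc ℂ) : LaurentSeries ℂ) = HahnSeries.C c := by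
    intro c
    rw [← RatFunc.algebraMap_C, ← IsScalarTower.algebraMap_apply, algebraMap_laurentSeries_eq,
      Polynomial.coe_C, PowerSeries.coe_C]
  rw [Polynomial.aeval_eq_sum_range, Finset.mul_sum, ratResidue_sum]
  have : ∀ k ∈ Finset.range (q.natDegree + 1), ratResidue ((RatFunc.X - RatFunc.C a)⁻¹ *
      (q.coeff k • (RatFunc.X - RatFunc.C a)⁻¹ ^ k)) a = if k = 0 then q.coeff 0 else 0 := by
    intro k _
    rw [mul_smul_comm, ← pow_succ', RatFunc.smul_eq_C_mul, ratResidue, map_mul, map_pow,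
      RatFunc.laurent_C, map_mul, map_pow, hX, hpow, hC, HahnSeries.C_mul_eq_smul,
      HahnSeries.coeff_smul, HahnSeries.coeff_single]
    rcases k with _ | k
    · simp
    · rw [if_neg (by push_cast; omega)]
      simp
  rw [Finset.sum_congr rfl this]
  simp

theorem ratResidue_partialFractionSum (p : Polynomial ℂ) (Q : ℂ →₀ Polynomial ℂ) (a : ℂ) :
    ratResidue (partialFractionSum p Q) a = (Q a).coeff 0 := by
  rw [partialFractionSum, ratResidue_add,
    ratResidue_eq_zero_of_isEval (RatFunc.IsEval.of_polynomial p), zero_add, Finsupp.sum,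
    ratResidue_sum, Finset.sum_eq_single a]
  · exact ratResidue_inv_mul_aeval a _
  · intro b _ hb
    have h := RatFunc.IsEval.inv_X_sub_C hb.symm
    exact ratResidue_eq_zero_of_isEval (h.mul (h.aeval (Q b)))
  · intro ha
    rw [Finsupp.notMem_support_iff.1 ha]
    simp [ratResidue]

theorem isEval_partialFractionSum (p : Polynomial ℂ) (Q : ℂ →₀ Polynomial ℂ) {v : ℂ}
    (hv : v ∉ Q.support) : RatFunc.IsEval v (partialFractionSum p Q)
      (p.eval v + Q.sum fun a q => (v - a)⁻¹ * q.eval (v - a)⁻¹) := by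
  refine (RatFunc.IsEval.of_polynomial p).add (RatFunc.IsEval.sum _ fun a ha => ?_)
  have h := RatFunc.IsEval.inv_X_sub_C (v := v) (a := a) (by rintro rfl; exact hv ha)
  exact h.mul (h.aeval _)

theorem Polynomial.exists_derivative_eq (q : Polynomial ℂ) :
    ∃ L : Polynomial ℂ, L.derivative = q := by
  induction q using Polynomial.induction_on' with
  | add p q hp hq =>
    obtain ⟨L, rfl⟩ := hp
    obtain ⟨M, rfl⟩ := hq
    exact ⟨L + M, by simp⟩
  | monomial n c =>
    refine ⟨Polynomial.monomial (n + 1) (c / (n + 1)), ?_⟩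
    rw [Polynomial.derivative_monomial]
    have : (n + 1 : ℂ) ≠ 0 := by exact_mod_cast n.succ_ne_zero
    simp [this]

/-! ### Analytic continuation of solutions -/

/-- Analytic continuations along consecutive paths can be concatenated. -/
theorem IsAnalyticContinuationAlong.trans {u : ℂ → ℂ} {z₀ z₁ z₂ : ℂ} {γ₁ : Path z₀ z₁}
    {γ₂ : Path z₁ z₂} {f₁ f₂ : unitInterval → ℂ → ℂ} (h₁ : IsAnalyticContinuationAlong u γ₁ f₁)
    (h₂ : IsAnalyticContinuationAlong (f₁ 1) γ₂ f₂) :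
    ∃ f, IsAnalyticContinuationAlong u (γ₁.trans γ₂) f ∧ f 1 = f₂ 1 := by
  classical
  set a : unitInterval → unitInterval := fun t => Set.projIcc 0 1 zero_le_one (2 * t : ℝ)
  set b : unitInterval → unitInterval := fun t => Set.projIcc 0 1 zero_le_one (2 * t - 1 : ℝ)
  have ha : Continuous a := continuous_projIcc.comp (by fun_prop)
  have hb : Continuous b := continuous_projIcc.comp (by fun_prop)
  have hγ₁ : ∀ t : unitInterval, (t : ℝ) ≤ 1 / 2 → (γ₁.trans γ₂) t = γ₁ (a t) := fun t ht =>
    if_pos ht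
  have hγ₂ : ∀ t : unitInterval, ¬ (t : ℝ) ≤ 1 / 2 → (γ₁.trans γ₂) t = γ₂ (b t) := fun t ht =>
    if_neg ht
  set f : unitInterval → ℂ → ℂ := fun t => if (t : ℝ) ≤ 1 / 2 then f₁ (a t) else f₂ (b t)
  have hf₁ : ∀ t : unitInterval, (t : ℝ) ≤ 1 / 2 → f t = f₁ (a t) := fun t ht => if_pos ht
  have hf₂ : ∀ t : unitInterval, ¬ (t : ℝ) ≤ 1 / 2 → f t = f₂ (b t) := fun t ht => if_neg ht
  have hcoe : Continuous fun t : unitInterval => (t : ℝ) := continuous_subtype_val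
  refine ⟨f, ⟨?_, fun t => ?_, fun t => ?_⟩, ?_⟩
  · have h0 : a 0 = 0 := by simp [a]
    have := h₁.start
    rw [hγ₁ 0 (by simp), hf₁ 0 (by simp), h0]
    exact this
  · by_cases ht : (t : ℝ) ≤ 1 / 2
    · rw [hf₁ t ht, hγ₁ t ht]
      exact h₁.analyticAt _
    · rw [hf₂ t ht, hγ₂ t ht]
      exact h₂.analyticAt _
  · rcases lt_trichotomy (t : ℝ) (1 / 2) with ht | ht | ht
    · filter_upwards [ha.continuousAt.eventually (h₁.compatible (a t)),
        hcoe.continuousAt.eventually (gt_mem_nhds ht)] with s hs hs'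
      rw [hf₁ s hs'.le, hγ₁ s hs'.le, hf₁ t ht.le]
      exact hs
    · have ha1 : a t = 1 := by
        simp [a, ht]
      have hb0 : b t = 0 := by
        simp [b, ht]
      have e1 := ha.continuousAt.eventually (h₁.compatible (a t))
      have e2 := hb.continuousAt.eventually (h₂.compatible (b t))
      have e3 : ∀ᶠ s in 𝓝 t, f₂ 0 =ᶠ[𝓝 (γ₂ (b s))] f₁ 1 := by
        have hc : ContinuousAt (fun s => γ₂ (b s)) t := (γ₂.continuous.comp hb).continuousAt
        refine hc.eventually (p := fun x => f₂ 0 =ᶠ[𝓝 x] f₁ 1) ?_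
        show ∀ᶠ y in 𝓝 (γ₂ (b t)), f₂ 0 =ᶠ[𝓝 y] f₁ 1
        rw [hb0]
        exact h₂.start.eventuallyEq_nhds
      rw [ha1] at e1
      rw [hb0] at e2
      filter_upwards [e1, e2, e3] with s h1 h2 h3
      rw [hf₁ t ht.le, ha1]
      by_cases hs : (s : ℝ) ≤ 1 / 2
      · rw [hf₁ s hs, hγ₁ s hs]
        exact h1
      · rw [hf₂ s hs, hγ₂ s hs]
        exact h2.trans h3
    · filter_upwards [hb.continuousAt.eventually (h₂.compatible (b t)),
        hcoe.continuousAt.eventually (lt_mem_nhds ht)] with s hs hs'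
      rw [hf₂ s hs'.not_ge, hγ₂ s hs'.not_ge, hf₂ t ht.not_ge]
      exact hs
  · have : b 1 = 1 := by simp [b]; norm_num
    rw [hf₂ 1 (by norm_num), this]

theorem eventually_eq_of_hasDerivAt_zero {g : ℂ → ℂ} {z : ℂ}
    (hg : ∀ᶠ x in 𝓝 z, HasDerivAt g 0 x) : ∀ᶠ x in 𝓝 z, g x = g z := by
  obtain ⟨ε, hε, hball⟩ := Metric.eventually_nhds_iff_ball.1 hg
  filter_upwards [Metric.ball_mem_nhds z hε] with x hx
  refine Metric.isOpen_ball.is_const_of_deriv_eq_zero (convex_ball z ε).isPreconnected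
    (fun y hy => (hball y hy).differentiableAt.differentiableWithinAt)
    (fun y hy => (hball y hy).deriv) hx (Metric.mem_ball_self hε)

/-- The germ of `u` at `z` solves `du/dz = R(u)` and takes the value `v` at `z`. -/
def IsSolutionGerm (R : RatFunc ℂ) (u : ℂ → ℂ) (z v : ℂ) : Prop :=
  u z = v ∧ ∀ᶠ x in 𝓝 z, R.denom.eval (u x) ≠ 0 ∧ HasDerivAt u (R.eval (RingHom.id ℂ) (u x)) x

/-- The reciprocal `1 / R` as a function. It has the junk value `0` at the zeros of `R`, where it is
never used. -/
noncomputable def RatFunc.recip (R : RatFunc ℂ) (v : ℂ) : ℂ := R.denom.eval v / R.num.eval v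

/-- `v` is neither a zero nor a pole of `R`. -/
def RatFunc.IsRegularValue (R : RatFunc ℂ) (v : ℂ) : Prop :=
  R.num.eval v ≠ 0 ∧ R.denom.eval v ≠ 0

namespace RatFunc

variable {R : RatFunc ℂ}

theorem eval_eq_num_div_denom (v : ℂ) :
    R.eval (RingHom.id ℂ) v = R.num.eval v / R.denom.eval v := rfl

theorem IsRegularValue.recip_ne_zero {v : ℂ} (h : R.IsRegularValue v) : R.recip v ≠ 0 :=
  div_ne_zero h.2 h.1

theorem inv_recip (v : ℂ) : (R.recip v)⁻¹ = R.eval (RingHom.id ℂ) v := by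
  rw [recip, inv_div, eval_eq_num_div_denom]

theorem IsRegularValue.recip_mul_eval {v : ℂ} (h : R.IsRegularValue v) :
    R.recip v * R.eval (RingHom.id ℂ) v = 1 := by
  rw [← inv_recip, mul_inv_cancel₀ h.recip_ne_zero]

theorem differentiableAt_recip {v : ℂ} (h : R.num.eval v ≠ 0) : DifferentiableAt ℂ R.recip v :=
  R.denom.differentiable.differentiableAt.div R.num.differentiable.differentiableAt h

end RatFunc

variable {R : RatFunc ℂ}

theorem IsSolutionGerm.analyticAt {u : ℂ → ℂ} {z v : ℂ} (h : IsSolutionGerm R u z v) :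
    AnalyticAt ℂ u z :=
  Complex.analyticAt_iff_eventually_differentiableAt.2 (h.2.mono fun _ hx => hx.2.differentiableAt)

/-- A solution germ through a regular value is determined by that value: a local primitive `F` of
`1 / R` is injective near the value, and both `F ∘ u₁` and `F ∘ u₂` have derivative `1`. -/
theorem IsSolutionGerm.eventuallyEq {u₁ u₂ : ℂ → ℂ} {z v : ℂ} (h₁ : IsSolutionGerm R u₁ z v)
    (h₂ : IsSolutionGerm R u₂ z v) (hv : R.IsRegularValue v) : u₁ =ᶠ[𝓝 z] u₂ := by
  have hN : ∀ᶠ x in 𝓝 v, R.IsRegularValue x :=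
    (R.num.continuous.continuousAt.eventually_ne hv.1).and
      (R.denom.continuous.continuousAt.eventually_ne hv.2)
  obtain ⟨r, hr, hball⟩ := Metric.eventually_nhds_iff_ball.1 hN
  obtain ⟨F, hF⟩ := DifferentiableOn.isExactOn_ball (f := R.recip) (c := v) (r := r) fun x hx =>
    (RatFunc.differentiableAt_recip (hball x hx).1).differentiableWithinAt
  have hFan : AnalyticAt ℂ F v := Complex.analyticAt_iff_eventually_differentiableAt.2 <|
    Filter.eventually_of_mem (Metric.ball_mem_nhds v hr) fun x hx => (hF x hx).differentiableAt
  have hFs : HasStrictDerivAt F (R.recip v) v := by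
    have := hFan.hasStrictDerivAt
    rwa [(hF v (Metric.mem_ball_self hr)).deriv] at this
  have hinv := hFs.eventually_left_inverse hv.recip_ne_zero
  have hu₁ : Tendsto u₁ (𝓝 z) (𝓝 v) := h₁.1 ▸ h₁.analyticAt.continuousAt
  have hu₂ : Tendsto u₂ (𝓝 z) (𝓝 v) := h₂.1 ▸ h₂.analyticAt.continuousAt
  have hd : ∀ {u : ℂ → ℂ}, IsSolutionGerm R u z v → Tendsto u (𝓝 z) (𝓝 v) →
      ∀ᶠ x in 𝓝 z, HasDerivAt (fun y => F (u y)) 1 x := by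
    intro u hu hut
    filter_upwards [hu.2, hut.eventually (Metric.ball_mem_nhds v hr)] with x hx hx'
    have := (hF _ hx').comp x hx.2
    rwa [(hball _ hx').recip_mul_eval] at this
  have hd' : ∀ᶠ x in 𝓝 z, HasDerivAt (fun y => F (u₁ y) - F (u₂ y)) 0 x := by
    filter_upwards [hd h₁ hu₁, hd h₂ hu₂] with x h1 h2
    exact (h1.fun_sub h2).congr_deriv (sub_self 1)
  filter_upwards [eventually_eq_of_hasDerivAt_zero hd', hu₁.eventually hinv, hu₂.eventually hinv]
    with x hx h1 h2
  rw [h₁.1, h₂.1, sub_self] at hx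
  rw [← h1, ← h2, sub_eq_zero.1 hx]

/-- If `H' = (1 / R)(q) q'`, then `q` composed with a local inverse of `H` solves
`du/dz = R(u)`. -/
theorem isSolutionGerm_comp_localInverse {q q' H ψ : ℂ → ℂ} {w : ℂ}
    (hq : ∀ᶠ x in 𝓝 w, HasDerivAt q (q' x) x)
    (hH : ∀ᶠ x in 𝓝 w, HasDerivAt H (R.recip (q x) * q' x) x)
    (hreg : ∀ᶠ x in 𝓝 w, R.IsRegularValue (q x)) (hψ : AnalyticAt ℂ ψ (H w)) (hψw : ψ (H w) = w)
    (hinv : ∀ᶠ x in 𝓝 (H w), H (ψ x) = x) : IsSolutionGerm R (fun x => q (ψ x)) (H w) (q w) := by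
  refine ⟨congrArg q hψw, ?_⟩
  have ht : Tendsto ψ (𝓝 (H w)) (𝓝 w) := by
    have := hψ.continuousAt.tendsto
    rwa [hψw] at this
  filter_upwards [ht.eventually hq, ht.eventually hH, ht.eventually hreg, hinv.eventually_nhds,
    hψ.eventually_analyticAt] with x h1 h2 h3 h4 h5
  refine ⟨h3.2, ?_⟩
  have e : R.recip (q (ψ x)) * q' (ψ x) * deriv ψ x = 1 :=
    (h2.comp x h5.differentiableAt.hasDerivAt).unique
      ((hasDerivAt_id x).congr_of_eventuallyEq h4)
  refine (h1.comp x h5.differentiableAt.hasDerivAt).congr_deriv ?_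
  rw [← RatFunc.inv_recip]
  exact eq_inv_of_mul_eq_one_right (by rw [← e, mul_assoc])

/-! ### Transit times and periods -/

/-- Every solution germ with value `v` at `z` can be continued to a solution germ with value `v'`
at `z'`. -/
def IsContinuable (R : RatFunc ℂ) (z v z' v' : ℂ) : Prop :=
  ∀ u, IsSolutionGerm R u z v → ∃ (γ : Path z z') (f : unitInterval → ℂ → ℂ),
    IsAnalyticContinuationAlong u γ f ∧ IsSolutionGerm R (f 1) z' v'

/-- `τ` is a transit time from `v` to `v'`: solutions with value `v` at `z` can be continued so as
to take the value `v'` at `z + τ`. The transit times are the values of `∫ dv / R(v)` along paths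
from `v` to `v'`. -/
def IsTransitTime (R : RatFunc ℂ) (v v' τ : ℂ) : Prop :=
  ∀ z z', z' = z + τ → IsContinuable R z v z' v'

theorem IsTransitTime.refl (v : ℂ) : IsTransitTime R v v 0 := by
  rintro z _ rfl u hu
  rw [add_zero]
  exact ⟨Path.refl z, fun _ => u, ⟨EventuallyEq.rfl, fun _ => hu.analyticAt,
    fun _ => Eventually.of_forall fun _ => EventuallyEq.rfl⟩, hu⟩

theorem IsTransitTime.trans {v v' v'' τ τ' : ℂ} (h : IsTransitTime R v v' τ)
    (h' : IsTransitTime R v' v'' τ') : IsTransitTime R v v'' (τ + τ') := by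
  intro z z' hz u hu
  obtain ⟨γ, f, hf, hf1⟩ := h z _ rfl u hu
  obtain ⟨γ', f', hf', hf1'⟩ := h' (z + τ) z' (by rw [hz, add_assoc]) _ hf1
  obtain ⟨g, hg, hg1⟩ := hf.trans hf'
  exact ⟨_, g, hg, hg1 ▸ hf1'⟩

/-- A holomorphic function with nonvanishing derivative has an analytic local inverse. -/
theorem exists_analytic_localInverse {H : ℂ → ℂ} {H' : ℂ → ℂ} {w : ℂ}
    (hH : ∀ᶠ x in 𝓝 w, HasDerivAt H (H' x) x) (h0 : H' w ≠ 0) :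
    ∃ ψ : ℂ → ℂ, AnalyticAt ℂ ψ (H w) ∧ ψ (H w) = w ∧ (∀ᶠ x in 𝓝 (H w), H (ψ x) = x) ∧
      ∀ᶠ x in 𝓝 w, ψ (H x) = x := by
  have han : AnalyticAt ℂ H w := Complex.analyticAt_iff_eventually_differentiableAt.2 <|
    hH.mono fun x hx => hx.differentiableAt
  have hd : deriv H w ≠ 0 := by rwa [hH.self_of_nhds.deriv]
  have hl := han.hasStrictDerivAt.eventually_left_inverse hd
  exact ⟨_, han.analyticAt_localInverse hd, hl.self_of_nhds,
    han.hasStrictDerivAt.eventually_right_inverse hd, hl⟩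

/-- Solutions are continued by inverting a primitive `H` of the pullback of `dv / R(v)` under a
holomorphic chart `q` with nonvanishing derivative. -/
theorem isContinuable_of_chart {O : Set ℂ} (hO : IsOpen O) (hOc : IsPathConnected O)
    {q q' H : ℂ → ℂ} (hq : ∀ w ∈ O, HasDerivAt q (q' w) w) (hq0 : ∀ w ∈ O, q' w ≠ 0)
    (hreg : ∀ w ∈ O, R.IsRegularValue (q w))
    (hH : ∀ w ∈ O, HasDerivAt H (R.recip (q w) * q' w) w) {w₀ w₁ : ℂ} (h₀ : w₀ ∈ O)
    (h₁ : w₁ ∈ O) : IsContinuable R (H w₀) (q w₀) (H w₁) (q w₁) := by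
  have hev : ∀ {p : ℂ → Prop}, (∀ w ∈ O, p w) → ∀ w ∈ O, ∀ᶠ x in 𝓝 w, p x := fun hp w hw =>
    Filter.eventually_of_mem (hO.mem_nhds hw) hp
  have hinv : ∀ w : O, ∃ ψ : ℂ → ℂ, AnalyticAt ℂ ψ (H w) ∧ ψ (H w) = w ∧
      (∀ᶠ x in 𝓝 (H w), H (ψ x) = x) ∧ ∀ᶠ x in 𝓝 (w : ℂ), ψ (H x) = x := fun w =>
    exists_analytic_localInverse (hev hH w w.2)
      (mul_ne_zero (hreg w w.2).recip_ne_zero (hq0 w w.2))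
  choose ψ hψ hψw hr hl using hinv
  have hsol : ∀ w : O, IsSolutionGerm R (fun x => q (ψ w x)) (H w) (q w) := fun w =>
    isSolutionGerm_comp_localInverse (hev hq w w.2) (hev hH w w.2) (hev hreg w w.2) (hψ w)
      (hψw w) (hr w)
  have hJ := hOc.joinedIn w₀ h₀ w₁ h₁
  set δ : Path w₀ w₁ := hJ.somePath
  have hδ : ∀ t, δ t ∈ O := hJ.somePath_mem
  have hHc : ContinuousOn H O := fun w hw => (hH w hw).continuousAt.continuousWithinAt
  let γ : Path (H w₀) (H w₁) :=
    { toFun := fun t => H (δ t)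
      continuous_toFun := hHc.comp_continuous δ.continuous hδ
      source' := by simp
      target' := by simp }
  intro u hu
  refine ⟨γ, fun t x => q (ψ ⟨δ t, hδ t⟩ x), ⟨?_, fun t => ?_, fun t => ?_⟩, ?_⟩
  · have h := hsol ⟨δ 0, hδ 0⟩
    have e : γ 0 = H w₀ := γ.source
    simp only [δ.source] at h
    rw [e]
    refine (IsSolutionGerm.eventuallyEq hu (?_ : IsSolutionGerm R _ _ _) (hreg w₀ h₀)).symm
    simpa using h
  · exact (hsol ⟨δ t, hδ t⟩).analyticAt
  · filter_upwards [δ.continuous.continuousAt.eventually (hl ⟨δ t, hδ t⟩).eventually_nhds]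
      with s hs
    have ht : Tendsto (ψ ⟨δ s, hδ s⟩) (𝓝 (H (δ s))) (𝓝 (δ s)) := by
      have := (hψ ⟨δ s, hδ s⟩).continuousAt.tendsto
      rwa [hψw] at this
    filter_upwards [ht.eventually hs, hr ⟨δ s, hδ s⟩] with y h1 h2
    rw [h2] at h1
    rw [h1]
  · have h := hsol ⟨δ 1, hδ 1⟩
    simp only [δ.target] at h
    simpa using h

theorem isTransitTime_of_chart {O : Set ℂ} (hO : IsOpen O) (hOc : IsPathConnected O)
    {q q' H : ℂ → ℂ} (hq : ∀ w ∈ O, HasDerivAt q (q' w) w) (hq0 : ∀ w ∈ O, q' w ≠ 0)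
    (hreg : ∀ w ∈ O, R.IsRegularValue (q w))
    (hH : ∀ w ∈ O, HasDerivAt H (R.recip (q w) * q' w) w) {w₀ w₁ : ℂ} (h₀ : w₀ ∈ O)
    (h₁ : w₁ ∈ O) : IsTransitTime R (q w₀) (q w₁) (H w₁ - H w₀) := by
  rintro z _ rfl
  have := isContinuable_of_chart hO hOc hq hq0 hreg
    (H := fun w => H w + (z - H w₀)) (fun w hw => (hH w hw).add_const _) h₀ h₁
  convert this using 1 <;> ring

/-- Nearby regular values are joined by transit times. -/
theorem eventually_isTransitTime {v : ℂ} (hv : R.IsRegularValue v) :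
    ∀ᶠ v' in 𝓝 v, ∃ τ, IsTransitTime R v v' τ ∧ IsTransitTime R v' v (-τ) := by
  have hN : ∀ᶠ x in 𝓝 v, R.IsRegularValue x :=
    (R.num.continuous.continuousAt.eventually_ne hv.1).and
      (R.denom.continuous.continuousAt.eventually_ne hv.2)
  obtain ⟨r, hr, hball⟩ := Metric.eventually_nhds_iff_ball.1 hN
  obtain ⟨F, hF⟩ := DifferentiableOn.isExactOn_ball (f := R.recip) (c := v) (r := r) fun x hx =>
    (RatFunc.differentiableAt_recip (hball x hx).1).differentiableWithinAt
  have key : ∀ w₀ ∈ Metric.ball v r, ∀ w₁ ∈ Metric.ball v r,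
      IsTransitTime R w₀ w₁ (F w₁ - F w₀) := fun w₀ h₀ w₁ h₁ =>
    isTransitTime_of_chart (q := fun w => w) (q' := fun _ => 1) Metric.isOpen_ball
      ((convex_ball v r).isPathConnected ⟨v, Metric.mem_ball_self hr⟩)
      (fun w _ => hasDerivAt_id w) (by simp) hball (by simpa using hF) h₀ h₁
  filter_upwards [Metric.ball_mem_nhds v hr] with w hw
  exact ⟨_, key _ (Metric.mem_ball_self hr) _ hw, by
    simpa using key _ hw _ (Metric.mem_ball_self hr)⟩

/-- Through every regular value there is a solution germ. -/
theorem exists_isSolutionGerm {v : ℂ} (hv : R.IsRegularValue v) (z : ℂ) :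
    ∃ u, IsSolutionGerm R u z v := by
  have hN : ∀ᶠ x in 𝓝 v, R.IsRegularValue x :=
    (R.num.continuous.continuousAt.eventually_ne hv.1).and
      (R.denom.continuous.continuousAt.eventually_ne hv.2)
  obtain ⟨r, hr, hball⟩ := Metric.eventually_nhds_iff_ball.1 hN
  obtain ⟨F, hF⟩ := DifferentiableOn.isExactOn_ball (f := R.recip) (c := v) (r := r) fun x hx =>
    (RatFunc.differentiableAt_recip (hball x hx).1).differentiableWithinAt
  have hb := Metric.ball_mem_nhds v hr
  have hH : ∀ᶠ x in 𝓝 v, HasDerivAt (fun w => F w + (z - F v)) (R.recip x * 1) x :=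
    Filter.eventually_of_mem hb fun x hx => by simpa using (hF x hx).add_const (z - F v)
  obtain ⟨ψ, h1, h2, h3, -⟩ := exists_analytic_localInverse
    (H' := fun x => R.recip x * 1) hH (by simpa using hv.recip_ne_zero)
  have := isSolutionGerm_comp_localInverse (q := fun w => w) (q' := fun _ => 1)
    (Eventually.of_forall fun x => hasDerivAt_id x) hH hN h1 h2 h3
  rw [add_sub_cancel] at this
  exact ⟨_, this⟩

/-- If infinitely many values have a common transit time from one regular value, then the solution
through that value is not finitely-valued. -/
theorem not_infinite_isTransitTime
    (hfin : ∀ (U : Set ℂ) (u : ℂ → ℂ), IsRatODESolution R U u → IsFinitelyValued U u)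
    {v₀ τ : ℂ} (hv₀ : R.IsRegularValue v₀) {I : Set ℂ} (hI : I.Infinite)
    (h : ∀ v ∈ I, IsTransitTime R v₀ v τ) : False := by
  obtain ⟨u, hu⟩ := exists_isSolutionGerm hv₀ 0
  obtain ⟨r, hr, hball⟩ := Metric.eventually_nhds_iff_ball.1 hu.2
  have hsol : IsRatODESolution R (Metric.ball 0 r) u :=
    ⟨Metric.isOpen_ball,
      ((convex_ball 0 r).isPathConnected ⟨0, Metric.mem_ball_self hr⟩).isConnected,
      fun z hz => (hball z hz).1, fun z hz => (hball z hz).2⟩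
  refine hI ((hfin _ _ hsol (0 + τ)).subset fun v hv => ?_)
  obtain ⟨γ, f, hf, hf1⟩ := h v hv 0 _ rfl u hu
  exact ⟨_, ⟨0, Metric.mem_ball_self hr, γ, f, hf, rfl⟩, hf1.1⟩

/-- The common self-transit times of all values off the finite set `Z`, i.e. the periods of the
differential `dv / R(v)` on the complement of `Z`. -/
def periods (R : RatFunc ℂ) (Z : Finset ℂ) : AddSubgroup ℂ where
  carrier := {τ | ∀ v ∉ Z, IsTransitTime R v v τ ∧ IsTransitTime R v v (-τ)}
  zero_mem' v _ := by simpa using IsTransitTime.refl v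
  add_mem' ha hb v hv := ⟨(ha v hv).1.trans (hb v hv).1, by
    rw [neg_add]; exact (ha v hv).2.trans (hb v hv).2⟩
  neg_mem' ha v hv := ⟨(ha v hv).2, by simpa using (ha v hv).1⟩

/-- Periods can be moved to every base point, the complement of a finite set being connected. -/
theorem mem_periods {Z : Finset ℂ} (hZ : ∀ v ∉ Z, R.IsRegularValue v) {v τ : ℂ} (hv : v ∉ Z)
    (h : IsTransitTime R v v τ) (h' : IsTransitTime R v v (-τ)) : τ ∈ periods R Z := by
  intro w hw
  have hconn : IsPreconnected ((Z : Set ℂ)ᶜ) :=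
    (Z.countable_toSet.isPathConnected_compl_of_one_lt_rank
      (by simp [Complex.rank_real_complex])).isConnected.isPreconnected
  obtain ⟨σ, h1, h2⟩ : ∃ σ, IsTransitTime R w v σ ∧ IsTransitTime R v w (-σ) := by
    refine hconn.induction₂ (fun x y => ∃ σ, IsTransitTime R x y σ ∧ IsTransitTime R y x (-σ))
      (fun x hx => ?_) ?_ ?_ hw hv
    · exact nhdsWithin_le_nhds (eventually_isTransitTime (hZ x hx))
    · rintro x y z - - - ⟨σ, h1, h2⟩ ⟨σ', h1', h2'⟩
      exact ⟨σ + σ', h1.trans h1', by rw [neg_add_rev]; exact h2'.trans h2⟩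
    · rintro x y - - ⟨σ, h1, h2⟩
      exact ⟨-σ, h2, by simpa using h1⟩
  constructor
  · have := (h1.trans h).trans h2
    rwa [add_neg_cancel_comm] at this
  · have := (h1.trans h').trans h2
    rwa [add_neg_cancel_comm] at this

/-! ### Fibres near an essential singularity -/

/-- Casorati–Weierstrass, for a function `E` whose logarithmic derivative `e` is such that `t e(t)`
is unbounded: were the image not dense, `E` would be meromorphic at `0`, so that `t e(t)` would tend
to the order of `E`. -/
theorem dense_image_of_logDeriv_unbounded {E e : ℂ → ℂ} {δ : ℝ} (hδ : 0 < δ)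
    (hE : ∀ t, t ≠ 0 → ‖t‖ < δ → HasDerivAt E (E t * e t) t)
    (hE0 : ∀ t, t ≠ 0 → ‖t‖ < δ → E t ≠ 0)
    (hunb : ¬ ∃ C, ∀ᶠ t in 𝓝[≠] (0 : ℂ), ‖t * e t‖ ≤ C) :
    Dense (E '' {t | t ≠ 0 ∧ ‖t‖ < δ}) := by
  by_contra hd
  apply hunb
  have hpd : ∀ᶠ t in 𝓝[≠] (0 : ℂ), t ≠ 0 ∧ ‖t‖ < δ := by
    filter_upwards [self_mem_nhdsWithin, nhdsWithin_le_nhds (Metric.ball_mem_nhds (0 : ℂ) hδ)]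
      with t ht ht'
    exact ⟨ht, by simpa using ht'⟩
  obtain ⟨y, r, hr, hy⟩ : ∃ y, ∃ r > 0, ∀ t, t ≠ 0 → ‖t‖ < δ → r ≤ ‖E t - y‖ := by
    simp only [Metric.dense_iff, not_forall, Set.not_nonempty_iff_eq_empty] at hd
    obtain ⟨y, r, hr, he⟩ := hd
    refine ⟨y, r, hr, fun t ht ht' => ?_⟩
    by_contra hlt
    have : E t ∈ Metric.ball y r ∩ E '' {t | t ≠ 0 ∧ ‖t‖ < δ} :=
      ⟨by simpa [dist_eq_norm] using hlt, t, ⟨ht, ht'⟩, rfl⟩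
    rw [he] at this
    exact this
  set g : ℂ → ℂ := fun t => (E t - y)⁻¹ with hg
  have hne : ∀ t, t ≠ 0 → ‖t‖ < δ → E t - y ≠ 0 := fun t ht ht' h0 => by
    have := hy t ht ht'
    rw [h0, norm_zero] at this
    linarith
  have hG := Complex.differentiableOn_update_limUnder_of_bddAbove (f := g) (c := 0)
    (Metric.ball_mem_nhds 0 hδ)
    (fun t ht => by
      have ht' : ‖t‖ < δ := by simpa using ht.1
      exact (((hE t ht.2 ht').differentiableAt.sub_const y).inv
        (hne t ht.2 ht')).differentiableWithinAt)
    ⟨r⁻¹, by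
      rintro _ ⟨t, ht, rfl⟩
      have ht' : ‖t‖ < δ := by simpa using ht.1
      simp only [Function.comp_apply, hg, norm_inv]
      exact inv_anti₀ hr (hy t ht.2 ht')⟩
  set G := Function.update g 0 (limUnder (𝓝[≠] 0) g)
  have hGan : AnalyticAt ℂ G 0 := hG.analyticAt (Metric.ball_mem_nhds 0 hδ)
  have hmer : MeromorphicAt E 0 := by
    refine ((MeromorphicAt.const y 0).add hGan.meromorphicAt.inv).congr ?_
    filter_upwards [hpd] with t ht
    simp [G, g, Function.update_of_ne ht.1]
  have htop : meromorphicOrderAt E 0 ≠ ⊤ := by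
    rw [meromorphicOrderAt_ne_top_iff_eventually_ne_zero hmer]
    filter_upwards [hpd] with t ht using hE0 t ht.1 ht.2
  obtain ⟨k, hk, hk0, hEk⟩ := (meromorphicOrderAt_ne_top_iff hmer).1 htop
  set n := (meromorphicOrderAt E 0).untop₀
  have hlim : Tendsto (fun t => (n : ℂ) + t * (deriv k t / k t)) (𝓝 0)
      (𝓝 (n + 0 * (deriv k 0 / k 0))) := by
    have : ContinuousAt (fun t => (n : ℂ) + t * (deriv k t / k t)) 0 :=
      continuousAt_const.add (continuousAt_id.mul (hk.deriv.continuousAt.div hk.continuousAt hk0))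
    exact this
  refine ⟨‖(n : ℂ) + 0 * (deriv k 0 / k 0)‖ + 1, ?_⟩
  have hbd := hlim.norm.eventually (gt_mem_nhds (lt_add_one _))
  filter_upwards [hpd, eventually_eventually_nhdsWithin.2 hEk,
    nhdsWithin_le_nhds hk.eventually_analyticAt, nhdsWithin_le_nhds hbd,
    nhdsWithin_le_nhds (hk.continuousAt.eventually_ne hk0)] with t ht h1 h2 h3 h4
  have hEt : E =ᶠ[𝓝 t] fun x => x ^ n * k x := by
    rw [nhdsWithin_eq_nhds.2 (isOpen_compl_singleton.mem_nhds ht.1)] at h1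
    filter_upwards [h1] with x hx
    simpa using hx
  have hder : HasDerivAt E ((n * t ^ (n - 1)) * k t + t ^ n * deriv k t) t :=
    ((hasDerivAt_zpow n t (Or.inl ht.1)).mul h2.differentiableAt.hasDerivAt).congr_of_eventuallyEq
      hEt
  have e1 := (hE t ht.1 ht.2).unique hder
  rw [hEt.self_of_nhds, zpow_sub_one₀ ht.1] at e1
  have htn : t ^ n ≠ 0 := zpow_ne_zero _ ht.1
  have e2 : t * e t = n + t * (deriv k t / k t) := by
    have ht0 := ht.1
    field_simp at e1 ⊢
    linear_combination e1
  rw [e2]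
  exact h3.le

/-- Near a singularity of the kind considered in `dense_image_of_logDeriv_unbounded` some value is
taken infinitely often, by the Baire category theorem. -/
theorem exists_infinite_fiber {E e : ℂ → ℂ} {ε : ℝ} (hε : 0 < ε)
    (hE : ∀ t, t ≠ 0 → ‖t‖ < ε → HasDerivAt E (E t * e t) t)
    (hE0 : ∀ t, t ≠ 0 → ‖t‖ < ε → E t ≠ 0) (he0 : ∀ t, t ≠ 0 → ‖t‖ < ε → e t ≠ 0)
    (hunb : ¬ ∃ C, ∀ᶠ t in 𝓝[≠] (0 : ℂ), ‖t * e t‖ ≤ C) :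
    ∃ y, {t | t ≠ 0 ∧ ‖t‖ < ε ∧ E t = y}.Infinite := by
  have hle : ∀ n : ℕ, ε / (n + 1) ≤ ε := fun n =>
    div_le_self hε.le (by linarith [n.cast_nonneg (α := ℝ)])
  have hpos : ∀ n : ℕ, 0 < ε / (n + 1 : ℝ) := fun n => by positivity
  set D : ℕ → Set ℂ := fun n => {t | t ≠ 0 ∧ ‖t‖ < ε / (n + 1)}
  have hDo : ∀ n, IsOpen (D n) := fun n =>
    isOpen_compl_singleton.inter (isOpen_lt continuous_norm continuous_const)
  have hopen : ∀ n, IsOpen (E '' D n) := by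
    intro n
    rw [isOpen_iff_mem_nhds]
    rintro _ ⟨t, ht, rfl⟩
    have han : AnalyticAt ℂ E t := by
      refine Complex.analyticAt_iff_eventually_differentiableAt.2
        (Filter.eventually_of_mem ((hDo n).mem_nhds ht) fun x hx => ?_)
      exact (hE x hx.1 (hx.2.trans_le (hle n))).differentiableAt
    have hd : deriv E t ≠ 0 := by
      rw [(hE t ht.1 (ht.2.trans_le (hle n))).deriv]
      exact mul_ne_zero (hE0 t ht.1 (ht.2.trans_le (hle n))) (he0 t ht.1 (ht.2.trans_le (hle n)))
    rw [← han.hasStrictDerivAt.map_nhds_eq hd]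
    exact image_mem_map ((hDo n).mem_nhds ht)
  have hdense : ∀ n, Dense (E '' D n) := fun n =>
    dense_image_of_logDeriv_unbounded (hpos n) (fun t ht ht' => hE t ht (ht'.trans_le (hle n)))
      (fun t ht ht' => hE0 t ht (ht'.trans_le (hle n))) hunb
  obtain ⟨y, hy⟩ := (dense_iInter_of_isOpen_nat hopen hdense).nonempty
  refine ⟨y, fun hfin => ?_⟩
  have hev : ∀ᶠ n : ℕ in atTop, ∀ t ∈ {t | t ≠ 0 ∧ ‖t‖ < ε ∧ E t = y}, ε / (n + 1) < ‖t‖ := by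
    rw [eventually_all_finite hfin]
    intro t ht
    have : Tendsto (fun n : ℕ => ε / (n + 1 : ℝ)) atTop (𝓝 0) := by
      simpa [div_eq_mul_inv] using
        (tendsto_one_div_add_atTop_nhds_zero_nat (𝕜 := ℝ)).const_mul ε
    exact this.eventually (gt_mem_nhds (norm_pos_iff.2 ht.1))
  obtain ⟨n, hn⟩ := hev.exists
  obtain ⟨t, ht, hty⟩ := Set.mem_iInter.1 hy n
  exact absurd ht.2 (hn t ⟨ht.1, ht.2.trans_le (hle n), hty⟩).not_gt

/-! ### Local models of the differential at a puncture -/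

/-- A local model of the differential `dv / R(v)` at a puncture of the complement of `Z` in the
Riemann sphere: the chart `q` parametrizes a punctured neighbourhood by `0 < |t| < ε`, and in this
chart the differential is `(t⁻¹ Q(t⁻¹) + h(t)) dt` with a polynomial `Q` and a holomorphic `h`.
The charts that occur, `t ↦ a + t` and `t ↦ t⁻¹`, are injective as functions on all of `ℂ`. -/
structure IsLocalModel (R : RatFunc ℂ) (Z : Finset ℂ) (q q' : ℂ → ℂ) (Q : Polynomial ℂ)
    (h : ℂ → ℂ) (ε : ℝ) : Prop where
  pos : 0 < ε
  notMem : ∀ t, t ≠ 0 → ‖t‖ < ε → q t ∉ Z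
  hasDerivAt : ∀ t, t ≠ 0 → ‖t‖ < ε → HasDerivAt q (q' t) t
  deriv_ne_zero : ∀ t, t ≠ 0 → ‖t‖ < ε → q' t ≠ 0
  injective : Function.Injective q
  differentiableOn : DifferentiableOn ℂ h (Metric.ball 0 ε)
  pullback : ∀ t, t ≠ 0 → ‖t‖ < ε → R.recip (q t) * q' t = t⁻¹ * Q.eval t⁻¹ + h t

/-- The function `ρ w + L(e⁻ʷ) + k(eʷ)` of the logarithmic coordinate `w = log t`. It is a
primitive of the differential of a local model if `ρ` is the constant coefficient of `Q`,
`L' = -(Q - ρ) / X` and `k' = h`. -/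
noncomputable def logPrimitive (ρ : ℂ) (L : Polynomial ℂ) (k : ℂ → ℂ) (w : ℂ) : ℂ :=
  ρ * w + (L.eval (Complex.exp w)⁻¹ + k (Complex.exp w))

namespace IsLocalModel

variable {R : RatFunc ℂ} {Z : Finset ℂ} {q q' h k : ℂ → ℂ} {Q L : Polynomial ℂ} {ε : ℝ}

theorem exists_primitive (hM : IsLocalModel R Z q q' Q h ε) :
    ∃ k : ℂ → ℂ, ∀ t, ‖t‖ < ε → HasDerivAt k (h t) t := by
  obtain ⟨k, hk⟩ := hM.differentiableOn.isExactOn_ball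
  exact ⟨k, fun t ht => hk t (by simpa using ht)⟩

/-- The differential of a local model, with the residue split off from the derivative of
`L(t⁻¹) + k(t)`. -/
theorem pullback_eq (hM : IsLocalModel R Z q q' Q h ε) (hL : L.derivative = -Q.divX) {t : ℂ}
    (ht : t ≠ 0) (ht' : ‖t‖ < ε) :
    R.recip (q t) * q' t = Q.coeff 0 * t⁻¹ + (-(L.derivative.eval t⁻¹) * (t ^ 2)⁻¹ + h t) := by
  rw [hM.pullback t ht ht', hL]
  conv_lhs => rw [← Polynomial.divX_mul_X_add Q]
  simp only [Polynomial.eval_add, Polynomial.eval_mul, Polynomial.eval_X, Polynomial.eval_C,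
    Polynomial.eval_neg]
  field_simp
  ring

theorem hasDerivAt_polarPart (hk : ∀ t, ‖t‖ < ε → HasDerivAt k (h t) t) {t : ℂ}
    (ht : t ≠ 0) (ht' : ‖t‖ < ε) : HasDerivAt (fun t => L.eval t⁻¹ + k t)
      (-(L.derivative.eval t⁻¹) * (t ^ 2)⁻¹ + h t) t := by
  refine HasDerivAt.fun_add ?_ (hk t ht')
  exact ((L.hasDerivAt t⁻¹).comp t (hasDerivAt_inv ht)).congr_deriv (by ring)

theorem hasDerivAt_logPrimitive (hM : IsLocalModel R Z q q' Q h ε) (hL : L.derivative = -Q.divX)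
    (hk : ∀ t, ‖t‖ < ε → HasDerivAt k (h t) t) {w : ℂ} (hw : ‖Complex.exp w‖ < ε) :
    HasDerivAt (logPrimitive (Q.coeff 0) L k)
      (R.recip (q (Complex.exp w)) * (q' (Complex.exp w) * Complex.exp w)) w := by
  have h0 := Complex.exp_ne_zero w
  have h1 := (hasDerivAt_polarPart (L := L) hk h0 hw).comp w (Complex.hasDerivAt_exp w)
  refine (((hasDerivAt_id w).const_mul (Q.coeff 0)).add h1).congr_deriv ?_
  rw [← mul_assoc, hM.pullback_eq hL h0 hw]
  field_simp

/-- Differences of the logarithmic primitive are transit times. -/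
theorem isTransitTime (hM : IsLocalModel R Z q q' Q h ε) (hZ : ∀ v ∉ Z, R.IsRegularValue v)
    (hL : L.derivative = -Q.divX) (hk : ∀ t, ‖t‖ < ε → HasDerivAt k (h t) t) {w₀ w₁ : ℂ}
    (h₀ : ‖Complex.exp w₀‖ < ε) (h₁ : ‖Complex.exp w₁‖ < ε) :
    IsTransitTime R (q (Complex.exp w₀)) (q (Complex.exp w₁))
      (logPrimitive (Q.coeff 0) L k w₁ - logPrimitive (Q.coeff 0) L k w₀) := by
  have hset : {w : ℂ | ‖Complex.exp w‖ < ε} = {w : ℂ | w.re < Real.log ε} := by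
    ext w
    rw [Set.mem_ofPred_eq, Set.mem_ofPred_eq, Complex.norm_exp, Real.lt_log_iff_exp_lt hM.pos]
  refine isTransitTime_of_chart (O := {w : ℂ | ‖Complex.exp w‖ < ε})
    (q := fun w => q (Complex.exp w)) (q' := fun w => q' (Complex.exp w) * Complex.exp w)
    ?_ ?_ (fun w hw => ?_) (fun w hw => ?_) (fun w hw => ?_) (fun w hw => ?_) h₀ h₁
  · exact isOpen_lt (by fun_prop) continuous_const
  · rw [hset]
    exact (convex_halfSpace_re_lt _).isPathConnected (hset ▸ ⟨w₀, h₀⟩)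
  · exact (hM.hasDerivAt _ (Complex.exp_ne_zero w) hw).comp w (Complex.hasDerivAt_exp w)
  · exact mul_ne_zero (hM.deriv_ne_zero _ (Complex.exp_ne_zero w) hw) (Complex.exp_ne_zero w)
  · exact hZ _ (hM.notMem _ (Complex.exp_ne_zero w) hw)
  · exact hM.hasDerivAt_logPrimitive hL hk hw

/-- The residue theorem: `2πi` times the residue of a local model is a period. -/
theorem residue_mem_periods (hM : IsLocalModel R Z q q' Q h ε)
    (hZ : ∀ v ∉ Z, R.IsRegularValue v) :
    2 * Real.pi * Complex.I * Q.coeff 0 ∈ periods R Z := by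
  obtain ⟨L, hL⟩ := Polynomial.exists_derivative_eq (-Q.divX)
  obtain ⟨k, hk⟩ := hM.exists_primitive
  have hε2 : ((ε / 2 : ℝ) : ℂ) ≠ 0 := by
    exact_mod_cast (half_pos hM.pos).ne'
  set w₀ := Complex.log (ε / 2 : ℝ)
  have e0 : Complex.exp w₀ = (ε / 2 : ℝ) := Complex.exp_log hε2
  have h0 : ‖Complex.exp w₀‖ < ε := by
    rw [e0, Complex.norm_real, Real.norm_of_nonneg (half_pos hM.pos).le]
    exact half_lt_self hM.pos
  have hper : Complex.exp (w₀ + 2 * Real.pi * Complex.I) = Complex.exp w₀ :=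
    Complex.exp_periodic w₀
  have h1 : ‖Complex.exp (w₀ + 2 * Real.pi * Complex.I)‖ < ε := by rwa [hper]
  have hd : logPrimitive (Q.coeff 0) L k (w₀ + 2 * Real.pi * Complex.I) -
      logPrimitive (Q.coeff 0) L k w₀ = 2 * Real.pi * Complex.I * Q.coeff 0 := by
    simp only [logPrimitive, hper]
    ring
  have t1 := hM.isTransitTime hZ hL hk h0 h1
  have t2 := hM.isTransitTime hZ hL hk h1 h0
  rw [hper, hd] at t1
  rw [hper, ← neg_sub, hd] at t2
  exact mem_periods hZ (hM.notMem _ (Complex.exp_ne_zero _) h0) t1 t2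

/-- If the multivalued primitive of a local model takes values in one class modulo periods at
infinitely many points, then some solution is not finitely-valued. -/
theorem not_infinite_fiber (hM : IsLocalModel R Z q q' Q h ε)
    (hfin : ∀ (U : Set ℂ) (u : ℂ → ℂ), IsRatODESolution R U u → IsFinitelyValued U u)
    (hZ : ∀ v ∉ Z, R.IsRegularValue v)
    (hL : L.derivative = -Q.divX) (hk : ∀ t, ‖t‖ < ε → HasDerivAt k (h t) t)
    {I : Set ℂ} (hI : I.Infinite) (hIε : ∀ t ∈ I, t ≠ 0 ∧ ‖t‖ < ε)
    (hIp : ∀ s ∈ I, ∀ t ∈ I, logPrimitive (Q.coeff 0) L k (Complex.log t) -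
      logPrimitive (Q.coeff 0) L k (Complex.log s) ∈ periods R Z) : False := by
  obtain ⟨s, hs⟩ := hI.nonempty
  have hexp : ∀ t ∈ I, Complex.exp (Complex.log t) = t := fun t ht => Complex.exp_log (hIε t ht).1
  have hsZ := hM.notMem s (hIε s hs).1 (hIε s hs).2
  refine not_infinite_isTransitTime hfin (hZ _ hsZ) (τ := 0)
    (hI.image hM.injective.injOn) ?_
  rintro _ ⟨t, ht, rfl⟩
  have h1 := hM.isTransitTime hZ hL hk (w₀ := Complex.log s) (w₁ := Complex.log t)
    (by rw [hexp s hs]; exact (hIε s hs).2) (by rw [hexp t ht]; exact (hIε t ht).2)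
  rw [hexp s hs, hexp t ht] at h1
  -- a closed loop at the starting value cancels the elapsed time, which is a period
  have h2 := (hIp s hs t ht _ hsZ).2.trans h1
  rwa [neg_add_cancel] at h2

/-- If all solutions are finitely-valued and there is a nonzero period, then the differential has at
most a simple pole at every puncture: otherwise the exponential of a suitable multiple of its
primitive is single-valued with an essential singularity there. -/
theorem degree_le_zero (hM : IsLocalModel R Z q q' Q h ε)
    (hfin : ∀ (U : Set ℂ) (u : ℂ → ℂ), IsRatODESolution R U u → IsFinitelyValued U u)
    (hZ : ∀ v ∉ Z, R.IsRegularValue v) {l : ℂ} (hl : l ∈ periods R Z) (hl0 : l ≠ 0) :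
    Q.degree ≤ 0 := by
  by_contra hdeg
  rw [not_le] at hdeg
  obtain ⟨L, hL⟩ := Polynomial.exists_derivative_eq (-Q.divX)
  obtain ⟨k, hk⟩ := hM.exists_primitive
  -- `κ` is chosen so that `exp` of `κ` times the primitive has no monodromy around the puncture and
  -- determines the primitive modulo the period `p`
  obtain ⟨p, hp, m, κ, hκp, hκQ⟩ : ∃ p ∈ periods R Z, ∃ (m : ℕ) (κ : ℂ),
      κ * p = 2 * Real.pi * Complex.I ∧ κ * Q.coeff 0 = m := by
    by_cases h0 : Q.coeff 0 = 0
    · exact ⟨l, hl, 0, 2 * Real.pi * Complex.I / l, div_mul_cancel₀ _ hl0, by simp [h0]⟩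
    · refine ⟨_, hM.residue_mem_periods hZ, 1, (Q.coeff 0)⁻¹, ?_, by simp [h0]⟩
      field_simp
  have hκ : κ ≠ 0 := by
    rintro rfl
    rw [zero_mul] at hκp
    exact Complex.two_pi_I_ne_zero hκp.symm
  set E : ℂ → ℂ := fun t => t ^ m * Complex.exp (κ * (L.eval t⁻¹ + k t)) with hEdef
  set e : ℂ → ℂ := fun t => κ * (R.recip (q t) * q' t) with hedef
  have hE : ∀ t, t ≠ 0 → ‖t‖ < ε → HasDerivAt E (E t * e t) t := by
    intro t ht ht'
    refine ((hasDerivAt_pow m t).mul ((hasDerivAt_polarPart (L := L) hk ht ht').const_mul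
      κ).cexp).congr_deriv ?_
    have hm : (m : ℂ) * t ^ (m - 1) = m * (t ^ m * t⁻¹) := by
      rcases m with _ | m
      · simp
      · rw [Nat.add_sub_cancel, pow_succ, mul_inv_cancel_right₀ ht]
    simp only [hEdef, hedef]
    rw [hM.pullback_eq hL ht ht', hm, ← hκQ]
    ring
  have hE0 : ∀ t, t ≠ 0 → ‖t‖ < ε → E t ≠ 0 := fun t ht _ =>
    mul_ne_zero (pow_ne_zero _ ht) (Complex.exp_ne_zero _)
  have he0 : ∀ t, t ≠ 0 → ‖t‖ < ε → e t ≠ 0 := fun t ht ht' =>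
    mul_ne_zero hκ (mul_ne_zero (hZ _ (hM.notMem t ht ht')).recip_ne_zero
      (hM.deriv_ne_zero t ht ht'))
  have hunb : ¬ ∃ C, ∀ᶠ t in 𝓝[≠] (0 : ℂ), ‖t * e t‖ ≤ C := by
    rintro ⟨C, hC⟩
    have hh : Tendsto (fun t => ‖κ * (t * h t)‖) (𝓝[≠] 0) (𝓝 ‖κ * (0 * h 0)‖) := by
      have : ContinuousAt (fun t => κ * (t * h t)) 0 :=
        continuousAt_const.mul (continuousAt_id.mul (hM.differentiableOn.differentiableAt
          (Metric.ball_mem_nhds 0 hM.pos)).continuousAt)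
      exact this.norm.mono_left nhdsWithin_le_nhds
    have hbd := hh.eventually (gt_mem_nhds (lt_add_one _))
    have hQ : Tendsto (fun t : ℂ => ‖Q.eval t⁻¹‖) (𝓝[≠] 0) atTop :=
      Q.tendsto_norm_atTop hdeg (tendsto_norm_cobounded_atTop.comp tendsto_inv₀_nhdsNE_zero)
    have hκQ' := (hQ.const_mul_atTop (norm_pos_iff.2 hκ)).eventually_gt_atTop
      (C + (‖κ * (0 * h 0)‖ + 1))
    have hpd : ∀ᶠ t in 𝓝[≠] (0 : ℂ), t ≠ 0 ∧ ‖t‖ < ε := by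
      filter_upwards [self_mem_nhdsWithin,
        nhdsWithin_le_nhds (Metric.ball_mem_nhds (0 : ℂ) hM.pos)] with t ht ht'
      exact ⟨ht, by simpa using ht'⟩
    obtain ⟨t, h1, h2, h3, h4⟩ := (hC.and (hbd.and (hκQ'.and hpd))).exists
    have e1 : κ * Q.eval t⁻¹ = t * e t - κ * (t * h t) := by
      simp only [hedef]
      rw [hM.pullback t h4.1 h4.2]
      have := h4.1
      field_simp
      ring
    rw [← norm_mul, e1] at h3
    linarith [norm_sub_le (t * e t) (κ * (t * h t))]
  obtain ⟨y, hy⟩ := exists_infinite_fiber hM.pos hE hE0 he0 hunb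
  have hEH : ∀ t, t ≠ 0 → Complex.exp (κ * logPrimitive (Q.coeff 0) L k (Complex.log t)) = E t := by
    intro t ht
    rw [logPrimitive, Complex.exp_log ht, mul_add, ← mul_assoc, hκQ, Complex.exp_add,
      Complex.exp_nat_mul, Complex.exp_log ht]
  refine hM.not_infinite_fiber hfin hZ hL hk hy (fun t ht => ⟨ht.1, ht.2.1⟩) ?_
  intro s hs t ht
  have h1 : Complex.exp (κ * logPrimitive (Q.coeff 0) L k (Complex.log t)) =
      Complex.exp (κ * logPrimitive (Q.coeff 0) L k (Complex.log s)) := by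
    rw [hEH t ht.1, hEH s hs.1, ht.2.2, hs.2.2]
  obtain ⟨n, hn⟩ := Complex.exp_eq_exp_iff_exists_int.1 h1
  have h2 : logPrimitive (Q.coeff 0) L k (Complex.log t) -
      logPrimitive (Q.coeff 0) L k (Complex.log s) = n • p := by
    apply mul_left_cancel₀ hκ
    rw [mul_sub, hn, ← hκp, zsmul_eq_mul]
    ring
  rw [h2]
  exact zsmul_mem hp n

/-- If all solutions are finitely-valued, then every period is a rational multiple of the period
`2πiρ` around a simple pole with nonzero residue `ρ`: the exponential of the primitive over `ρ` is a
local coordinate `E` at the pole, a further period `l` acts on it by the multiplier `exp (l / ρ)` or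
its inverse, and if this is not a root of unity then infinitely many points of one orbit lie close
to `E = 0`. -/
theorem exists_rat_of_mem_periods {ρ : ℂ} (hρ : ρ ≠ 0)
    (hM : IsLocalModel R Z q q' (Polynomial.C ρ) h ε)
    (hfin : ∀ (U : Set ℂ) (u : ℂ → ℂ), IsRatODESolution R U u → IsFinitelyValued U u)
    (hZ : ∀ v ∉ Z, R.IsRegularValue v) {l : ℂ} (hl : l ∈ periods R Z) :
    ∃ r : ℚ, l = 2 * Real.pi * Complex.I * ρ * r := by
  -- passing to the period `-l` inverts the multiplier
  wlog hμ : ‖Complex.exp (l / ρ)‖ ≤ 1 generalizing l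
  · obtain ⟨r, hr⟩ := this (neg_mem hl) (by
      rw [neg_div, Complex.exp_neg, norm_inv]
      exact inv_le_one_of_one_le₀ (not_le.1 hμ).le)
    exact ⟨-r, by push_cast; rw [mul_neg, ← hr, neg_neg]⟩
  by_contra hirr
  set μ := Complex.exp (l / ρ) with hμdef
  have hμ0 : μ ≠ 0 := Complex.exp_ne_zero _
  have hpow : ∀ n : ℕ, n ≠ 0 → μ ^ n ≠ 1 := by
    intro n hn h1
    rw [hμdef, ← Complex.exp_nat_mul, Complex.exp_eq_one_iff] at h1
    obtain ⟨j, hj⟩ := h1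
    apply hirr
    refine ⟨(j : ℚ) / n, ?_⟩
    have hn' : (n : ℂ) ≠ 0 := by exact_mod_cast hn
    push_cast
    field_simp at hj ⊢
    linear_combination hj
  have hinj : Function.Injective fun n : ℕ => μ ^ n := by
    intro a b hab
    wlog hle : a ≤ b generalizing a b
    · exact (this hab.symm (not_le.1 hle).le).symm
    by_contra hne
    apply hpow (b - a) (by omega)
    have : μ ^ a * μ ^ (b - a) = μ ^ a * 1 := by
      rw [← pow_add, Nat.add_sub_cancel' hle, mul_one]
      exact hab.symm
    exact mul_left_cancel₀ (pow_ne_zero _ hμ0) this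
  obtain ⟨k, hk⟩ := hM.exists_primitive
  have hL : (0 : Polynomial ℂ).derivative = -(Polynomial.C ρ).divX := by simp
  set E : ℂ → ℂ := fun t => t * Complex.exp (k t / ρ) with hE
  have hkan : AnalyticAt ℂ k 0 := Complex.analyticAt_iff_eventually_differentiableAt.2 <|
    Filter.eventually_of_mem (Metric.ball_mem_nhds 0 hM.pos) fun t ht =>
      (hk t (by simpa using ht)).differentiableAt
  have hEs : HasStrictDerivAt E (Complex.exp (k 0 / ρ)) 0 := by
    refine ((hasStrictDerivAt_id (0 : ℂ)).mul
      (hkan.hasStrictDerivAt.div_const ρ).cexp).congr_deriv ?_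
    simp
  have hmem : E '' Metric.ball 0 ε ∈ 𝓝 (0 : ℂ) := by
    have h1 := hEs.map_nhds_eq (Complex.exp_ne_zero _)
    rw [show E 0 = 0 by simp [hE]] at h1
    rw [← h1]
    exact image_mem_map (Metric.ball_mem_nhds 0 hM.pos)
  obtain ⟨r, hr, hball⟩ := Metric.mem_nhds_iff.1 hmem
  have hr2 : ((r / 2 : ℝ) : ℂ) ≠ 0 := by exact_mod_cast (half_pos hr).ne'
  have hw : ∀ n : ℕ, ∃ t, ‖t‖ < ε ∧ E t = μ ^ n * (r / 2 : ℝ) := by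
    intro n
    have : μ ^ n * (r / 2 : ℝ) ∈ Metric.ball (0 : ℂ) r := by
      rw [mem_ball_zero_iff, norm_mul, norm_pow, Complex.norm_real,
        Real.norm_of_nonneg (half_pos hr).le]
      have := pow_le_one₀ (n := n) (norm_nonneg μ) hμ
      nlinarith
    obtain ⟨t, ht, hte⟩ := hball this
    exact ⟨t, by simpa using ht, hte⟩
  choose t ht hte using hw
  have ht0 : ∀ n, t n ≠ 0 := by
    intro n h0
    have := hte n
    rw [h0] at this
    simp only [hE, zero_mul] at this
    exact mul_ne_zero (pow_ne_zero n hμ0) hr2 this.symm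
  have htinj : Function.Injective t := by
    intro a b hab
    have := hte a
    rw [hab, hte b] at this
    exact (hinj (mul_right_cancel₀ hr2 this)).symm
  refine hM.not_infinite_fiber hfin hZ hL hk (Set.infinite_range_of_injective htinj) ?_ ?_
  · rintro _ ⟨n, rfl⟩
    exact ⟨ht0 n, ht n⟩
  have hEH : ∀ n, Complex.exp (logPrimitive ρ 0 k (Complex.log (t n)) / ρ) = E (t n) := by
    intro n
    rw [logPrimitive, Complex.exp_log (ht0 n), add_div, mul_div_cancel_left₀ _ hρ, Complex.exp_add,
      Complex.exp_log (ht0 n)]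
    simp [hE]
  have key : ∀ n, logPrimitive ρ 0 k (Complex.log (t n)) - logPrimitive ρ 0 k (Complex.log (t 0)) ∈
      periods R Z := by
    intro n
    have h1 : Complex.exp (logPrimitive ρ 0 k (Complex.log (t n)) / ρ) =
        Complex.exp (n * (l / ρ) + logPrimitive ρ 0 k (Complex.log (t 0)) / ρ) := by
      rw [Complex.exp_add, hEH, hEH, hte, hte, Complex.exp_nat_mul, pow_zero, one_mul]
    obtain ⟨j, hj⟩ := Complex.exp_eq_exp_iff_exists_int.1 h1
    have h2 : logPrimitive ρ 0 k (Complex.log (t n)) - logPrimitive ρ 0 k (Complex.log (t 0)) =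
        n • l + j • (2 * Real.pi * Complex.I * ρ) := by
      rw [nsmul_eq_mul, zsmul_eq_mul]
      field_simp at hj
      linear_combination hj
    rw [h2]
    refine add_mem (nsmul_mem hl n) (zsmul_mem ?_ j)
    simpa using hM.residue_mem_periods hZ
  rintro _ ⟨m, rfl⟩ _ ⟨n, rfl⟩
  rw [Polynomial.coeff_C_zero]
  simpa using sub_mem (key n) (key m)

end IsLocalModel

/-! ### The punctures of a rational differential -/

variable {p : Polynomial ℂ} {Q : ℂ →₀ Polynomial ℂ} {Z : Finset ℂ}

theorem RatFunc.recip_eq_of_partialFractions (hpf : R⁻¹ = partialFractionSum p Q) {v : ℂ}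
    (hv : R.num.eval v ≠ 0) (hvQ : v ∉ Q.support) :
    R.recip v = p.eval v + Q.sum fun a q => (v - a)⁻¹ * q.eval (v - a)⁻¹ :=
  (RatFunc.IsEval.inv_of_num_ne_zero hv).unique (hpf ▸ isEval_partialFractionSum p Q hvQ)

theorem exists_isLocalModel_finite (hZ : ∀ v ∉ Z, R.IsRegularValue v) (hQZ : Q.support ⊆ Z)
    (hpf : R⁻¹ = partialFractionSum p Q) (a : ℂ) :
    ∃ h ε, IsLocalModel R Z (fun t => a + t) (fun _ => 1) (Q a) h ε := by
  classical
  have hopen : (((Z.erase a : Finset ℂ) : Set ℂ)ᶜ) ∈ 𝓝 a :=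
    (Z.erase a).finite_toSet.isClosed.isOpen_compl.mem_nhds (by simp)
  obtain ⟨ε, hε, hball⟩ := Metric.mem_nhds_iff.1 hopen
  have hnot : ∀ t, t ≠ 0 → ‖t‖ < ε → a + t ∉ Z := by
    intro t ht ht' hm
    exact hball (by simpa using ht' : a + t ∈ Metric.ball a ε) (by simp [ht, hm])
  refine ⟨fun t => p.eval (a + t) + (Q.erase a).sum fun b q =>
    (a + t - b)⁻¹ * q.eval (a + t - b)⁻¹, ε, hε, hnot, fun t _ _ => ?_, fun _ _ _ => one_ne_zero,
    add_right_injective a, ?_, fun t ht ht' => ?_⟩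
  · exact (hasDerivAt_id t).const_add a
  · intro t ht
    refine DifferentiableAt.differentiableWithinAt ?_
    refine DifferentiableAt.fun_add (p.differentiable.differentiableAt.comp t (by fun_prop)) ?_
    refine DifferentiableAt.fun_sum fun b hb => ?_
    rw [Finsupp.support_erase, Finset.mem_erase] at hb
    have hne : a + t - b ≠ 0 := by
      intro h0
      have hb' : b ∈ Metric.ball a ε := by
        rw [← sub_eq_zero.1 h0]
        simpa using ht
      exact hball hb' (by simp [hb.1, hQZ hb.2])
    have hi : DifferentiableAt ℂ (fun t => (a + t - b)⁻¹) t :=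
      DifferentiableAt.fun_inv (by fun_prop) hne
    exact hi.fun_mul
      (DifferentiableAt.fun_comp' t (Polynomial.differentiable _).differentiableAt hi)
  · have hv := hnot t ht ht'
    rw [mul_one, RatFunc.recip_eq_of_partialFractions hpf (hZ _ hv).1 fun h => hv (hQZ h),
      ← Finsupp.add_sum_erase' Q a _ (by simp), add_sub_cancel_left]
    ring

/-- The sum of the principal parts at the finite poles in the coordinate `t = 1 / v`, divided
by `t`. -/
noncomputable def principalPartsAtInfty (Q : ℂ →₀ Polynomial ℂ) (t : ℂ) : ℂ :=
  Q.sum fun a q => (1 - a * t)⁻¹ * q.eval (t * (1 - a * t)⁻¹)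

theorem exists_isLocalModel_infty (hZ : ∀ v ∉ Z, R.IsRegularValue v) (hQZ : Q.support ⊆ Z)
    (hpf : R⁻¹ = partialFractionSum p Q) :
    ∃ h ε, IsLocalModel R Z (fun t => t⁻¹) (fun t => -(t ^ 2)⁻¹)
      (-(p * Polynomial.X) - Polynomial.C (principalPartsAtInfty Q 0)) h ε := by
  have hev : ∀ᶠ t in 𝓝[≠] (0 : ℂ), t⁻¹ ∉ Z :=
    tendsto_inv₀_nhdsNE_zero.eventually
      (Bornology.isBounded_def.1 Z.finite_toSet.isBounded)
  obtain ⟨ε, hε, hball⟩ := Metric.mem_nhdsWithin_iff.1 hev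
  have hnot : ∀ t, t ≠ 0 → ‖t‖ < ε → t⁻¹ ∉ Z := fun t ht ht' => hball ⟨by simpa using ht', ht⟩
  have hne : ∀ t, ‖t‖ < ε → ∀ a ∈ Q.support, 1 - a * t ≠ 0 := by
    intro t ht' a ha h0
    have ht : t ≠ 0 := by
      rintro rfl
      simp at h0
    apply hnot t ht ht'
    rw [← eq_inv_of_mul_eq_one_left (sub_eq_zero.1 h0).symm]
    exact hQZ ha
  have hY : DifferentiableOn ℂ (principalPartsAtInfty Q) (Metric.ball 0 ε) := by
    intro t ht
    refine DifferentiableAt.differentiableWithinAt (DifferentiableAt.fun_sum fun a ha => ?_)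
    have hi : DifferentiableAt ℂ (fun t => (1 - a * t)⁻¹) t :=
      DifferentiableAt.fun_inv (by fun_prop) (hne t (by simpa using ht) a ha)
    exact hi.fun_mul (DifferentiableAt.fun_comp' t (Polynomial.differentiable _).differentiableAt
      (differentiableAt_fun_id.fun_mul hi))
  refine ⟨fun t => -dslope (principalPartsAtInfty Q) 0 t, ε, hε, hnot, fun t ht _ =>
    hasDerivAt_inv ht, fun t ht _ => neg_ne_zero.2 (inv_ne_zero (pow_ne_zero 2 ht)),
    inv_injective, ?_, fun t ht ht' => ?_⟩
  · exact ((Complex.differentiableOn_dslope (Metric.ball_mem_nhds 0 hε)).2 hY).fun_neg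
  · have hv := hnot t ht ht'
    have hsum : (Q.sum fun a q => (t⁻¹ - a)⁻¹ * q.eval (t⁻¹ - a)⁻¹) =
        t * principalPartsAtInfty Q t := by
      rw [principalPartsAtInfty, Finsupp.mul_sum]
      refine Finsupp.sum_congr fun a ha => ?_
      have h1 := hne t ht' a ha
      have h2 : (t⁻¹ - a)⁻¹ = t * (1 - a * t)⁻¹ := by
        rw [show t⁻¹ - a = t⁻¹ * (1 - a * t) by field_simp, mul_inv, inv_inv]
      rw [h2, mul_assoc]
    rw [RatFunc.recip_eq_of_partialFractions hpf (hZ _ hv).1 fun h => hv (hQZ h), hsum,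
      dslope_of_ne _ ht, slope_def_field]
    simp only [Polynomial.eval_sub, Polynomial.eval_neg, Polynomial.eval_mul, Polynomial.eval_X,
      Polynomial.eval_C, sub_zero]
    field_simp
    ring

/-- If all solutions are finitely-valued and `1 / R` has a nonzero residue, then `1 / R` has only
simple poles, no polynomial part, and residues with rational ratios. -/
theorem exists_rational_residues
    (hfin : ∀ (U : Set ℂ) (u : ℂ → ℂ), IsRatODESolution R U u → IsFinitelyValued U u)
    (hR : R ≠ 0) {a₀ : ℂ} (ha₀ : ratResidue R⁻¹ a₀ ≠ 0) :
    ∃ n : ℕ, 0 < n ∧ ∃ (ξ : ℂ) (a : Fin n → ℂ) (β : Fin n → ℚ), ξ ≠ 0 ∧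
      R⁻¹ = RatFunc.C ξ * ∑ j, RatFunc.C (β j : ℂ) / (RatFunc.X - RatFunc.C (a j)) := by
  classical
  obtain ⟨p, Q, hpf⟩ := RatFunc.hasPartialFractions R⁻¹
  rw [hpf, ratResidue_partialFractionSum] at ha₀
  set ρ := (Q a₀).coeff 0
  set Z := R.num.roots.toFinset ∪ R.denom.roots.toFinset ∪ Q.support with hZdef
  have hQZ : Q.support ⊆ Z := Finset.subset_union_right
  have hZ : ∀ v ∉ Z, R.IsRegularValue v := by
    intro v hv
    simp only [hZdef, Finset.mem_union, not_or, Multiset.mem_toFinset] at hv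
    exact ⟨fun h => hv.1.1 ((Polynomial.mem_roots (RatFunc.num_ne_zero hR)).2 h),
      fun h => hv.1.2 ((Polynomial.mem_roots R.denom_ne_zero).2 h)⟩
  have hmod := exists_isLocalModel_finite hZ hQZ hpf
  obtain ⟨h₀, ε₀, hM₀⟩ := hmod a₀
  have hper := hM₀.residue_mem_periods hZ
  have hper0 : 2 * Real.pi * Complex.I * (Q a₀).coeff 0 ≠ 0 :=
    mul_ne_zero Complex.two_pi_I_ne_zero ha₀
  have hQC : ∀ b, Q b = Polynomial.C ((Q b).coeff 0) := by
    intro b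
    obtain ⟨h, ε, hM⟩ := hmod b
    exact Polynomial.eq_C_of_degree_le_zero (hM.degree_le_zero hfin hZ hper hper0)
  have hp : p = 0 := by
    obtain ⟨h, ε, hM⟩ := exists_isLocalModel_infty hZ hQZ hpf
    have hd := Polynomial.eq_C_of_degree_le_zero (hM.degree_le_zero hfin hZ hper hper0)
    ext n
    have := congrArg (fun q => Polynomial.coeff q (n + 1)) hd
    simpa [Polynomial.coeff_C] using this
  have hrat : ∀ b, ∃ r : ℚ, (Q b).coeff 0 = ρ * r := by
    intro b
    obtain ⟨h, ε, hM⟩ := hmod b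
    rw [hQC a₀] at hM₀
    obtain ⟨r, hr⟩ := IsLocalModel.exists_rat_of_mem_periods ha₀ hM₀ hfin hZ
      (hM.residue_mem_periods hZ)
    refine ⟨r, mul_left_cancel₀ Complex.two_pi_I_ne_zero ?_⟩
    rw [hr]
    ring
  choose β hβ using hrat
  have hmem : a₀ ∈ Q.support := by
    rw [Finsupp.mem_support_iff]
    intro h0
    apply ha₀
    simp [ρ, h0]
  let e := Q.support.equivFin
  refine ⟨Q.support.card, Finset.card_pos.2 ⟨a₀, hmem⟩, ρ, fun j => e.symm j,
    fun j => β (e.symm j), ha₀, ?_⟩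
  rw [hpf, partialFractionSum, hp, map_zero, zero_add, Finsupp.sum, Finset.mul_sum,
    ← Finset.sum_coe_sort, ← Equiv.sum_comp e.symm]
  refine Finset.sum_congr rfl fun j _ => ?_
  rw [hQC, Polynomial.aeval_C, RatFunc.algebraMap_eq_C, hβ, map_mul, div_eq_mul_inv]
  ring

/-! ### Solutions with an algebraic first integral -/

/-- Permanence of functional equations: a relation `A(u) = w B(u)` persists under analytic
continuation along a path. -/
theorem IsAnalyticContinuationAlong.polynomial_relation {A B : Polynomial ℂ} {w u : ℂ → ℂ}
    (hw : Differentiable ℂ w) {z₀ z₁ : ℂ} {γ : Path z₀ z₁} {f : unitInterval → ℂ → ℂ}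
    (hf : IsAnalyticContinuationAlong u γ f)
    (hu : ∀ᶠ x in 𝓝 z₀, A.eval (u x) - w x * B.eval (u x) = 0) :
    A.eval (f 1 z₁) - w z₁ * B.eval (f 1 z₁) = 0 := by
  set G : unitInterval → ℂ → ℂ := fun t x => A.eval (f t x) - w x * B.eval (f t x) with hG
  have hGan : ∀ t, AnalyticAt ℂ (G t) (γ t) := fun t =>
    ((hf.analyticAt t).aeval_polynomial A).sub
      ((hw.analyticAt _).mul ((hf.analyticAt t).aeval_polynomial B))
  have hGc : ∀ t, ∀ᶠ s in 𝓝 t, G s =ᶠ[𝓝 (γ s)] G t := fun t =>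
    (hf.compatible t).mono fun s hs => by
      filter_upwards [hs] with x hx
      simp only [hG, hx]
  set T : Set unitInterval := {t | ∀ᶠ x in 𝓝 (γ t), G t x = 0}
  have hopen : IsOpen T := by
    rw [isOpen_iff_mem_nhds]
    intro t ht
    filter_upwards [hGc t, γ.continuous.continuousAt.eventually ht.eventually_nhds] with s h1 h2
    exact h1.trans h2
  have hclosed : IsOpen Tᶜ := by
    rw [isOpen_iff_mem_nhds]
    intro t ht
    have hne : ∀ᶠ x in 𝓝[≠] (γ t), G t x ≠ 0 :=
      (hGan t).eventually_eq_zero_or_eventually_ne_zero.resolve_left ht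
    obtain ⟨V, hV, hVo, htV⟩ := eventually_nhds_iff.1 (eventually_nhdsWithin_iff.1 hne)
    filter_upwards [hGc t, γ.continuous.continuousAt.eventually (hVo.mem_nhds htV)] with s h1 h2
    intro hs
    have h3 : ∀ᶠ x in 𝓝 (γ s), G t x = 0 := (h1.symm.trans hs : _)
    obtain ⟨x, hxne, hx, hxV⟩ :=
      (dense_compl_singleton (γ t)).inter_nhds_nonempty (h3.and (hVo.mem_nhds h2))
    exact hV x hxV hxne hx
  have huniv : T = Set.univ := by
    refine IsClopen.eq_univ ⟨⟨hclosed⟩, hopen⟩ ⟨0, ?_⟩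
    have h0 := hf.start
    rw [γ.source] at h0
    show ∀ᶠ x in 𝓝 (γ 0), G 0 x = 0
    rw [γ.source]
    filter_upwards [h0, hu] with x h1 h2
    simp only [hG, h1, h2]
  have h1 : (1 : unitInterval) ∈ T := huniv ▸ Set.mem_univ _
  have h2 := Filter.Eventually.self_of_nhds h1
  simp only [hG, γ.target] at h2
  exact h2

/-- If `A(u) = w B(u)` holds near one point with an entire function `w`, then the values at `z` of
the maximal analytic extension of `u` are roots of the polynomial `A - w(z) B`. -/
theorem IsRatODESolution.isFinitelyValued_of_polynomial_relation {U : Set ℂ} {u : ℂ → ℂ}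
    (hu : IsRatODESolution R U u) {A B : Polynomial ℂ} {w : ℂ → ℂ} (hw : Differentiable ℂ w)
    (hne : ∀ z, A - Polynomial.C (w z) * B ≠ 0) {z₁ : ℂ} (hz₁ : z₁ ∈ U)
    (h : ∀ᶠ x in 𝓝 z₁, A.eval (u x) - w x * B.eval (u x) = 0) : IsFinitelyValued U u := by
  have huan : AnalyticOnNhd ℂ u U := DifferentiableOn.analyticOnNhd
    (fun z hz => (hu.hasDerivAt z hz).differentiableAt.differentiableWithinAt) hu.isOpen
  have hGan : AnalyticOnNhd ℂ (fun x => A.eval (u x) - w x * B.eval (u x)) U := fun z hz =>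
    ((huan z hz).aeval_polynomial A).sub
      ((hw.analyticAt _).mul ((huan z hz).aeval_polynomial B))
  have hzero := hGan.eqOn_zero_of_preconnected_of_eventuallyEq_zero hu.isConnected.isPreconnected
    hz₁ h
  intro z
  refine ((A - Polynomial.C (w z) * B).roots.toFinset.finite_toSet).subset ?_
  rintro _ ⟨_, ⟨z₀, hz₀, γ, f, hf, rfl⟩, rfl⟩
  have := hf.polynomial_relation hw (A := A) (B := B)
    (Filter.eventually_of_mem (hu.isOpen.mem_nhds hz₀) hzero)
  simpa [hne z] using this

/-- The local solutions of `y' = α + κ y` extend to entire functions. -/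
theorem exists_entire_of_linear_ode {y : ℂ → ℂ} {α κ z : ℂ}
    (hy : ∀ᶠ x in 𝓝 z, HasDerivAt y (α + κ * y x) x) :
    ∃ w : ℂ → ℂ, Differentiable ℂ w ∧ ∀ᶠ x in 𝓝 z, y x = w x := by
  rcases eq_or_ne κ 0 with rfl | hκ
  · have h : ∀ᶠ x in 𝓝 z, HasDerivAt (fun x => y x - α * x) 0 x := by
      filter_upwards [hy] with x hx
      exact (hx.fun_sub ((hasDerivAt_id x).const_mul α)).congr_deriv (by simp)
    refine ⟨fun x => y z - α * z + α * x, by fun_prop, ?_⟩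
    filter_upwards [eventually_eq_of_hasDerivAt_zero h] with x hx
    rw [← hx]
    ring
  · have h : ∀ᶠ x in 𝓝 z, HasDerivAt (fun x => Complex.exp (-(κ * x)) * (y x + α / κ)) 0 x := by
      filter_upwards [hy] with x hx
      refine (((hasDerivAt_id x).const_mul κ).fun_neg.cexp.fun_mul
        (hx.add_const (α / κ))).congr_deriv ?_
      simp only [id]
      field_simp
      ring
    refine ⟨fun x => Complex.exp (κ * x) * (Complex.exp (-(κ * z)) * (y z + α / κ)) - α / κ,
      by fun_prop, ?_⟩
    filter_upwards [eventually_eq_of_hasDerivAt_zero h] with x hx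
    rw [← hx, ← mul_assoc, ← Complex.exp_add, add_neg_cancel, Complex.exp_zero]
    ring

/-- If a nonconstant rational function `Φ = A / B` satisfies `dΦ(u)/dz = α + κ Φ(u)` along all
solutions `u`, then solutions are finitely-valued, as `Φ(u)` is entire. The zeros of `K` are
exceptional values. -/
theorem IsRatODESolution.isFinitelyValued_of_integral {U : Set ℂ} {u : ℂ → ℂ}
    (hu : IsRatODESolution R U u) {K A B : Polynomial ℂ} {Φ Φ' : ℂ → ℂ} {α κ : ℂ} (hK : K ≠ 0)
    (hB : ∀ v, K.eval v ≠ 0 → B.eval v ≠ 0) (hΦ : ∀ v, K.eval v ≠ 0 → Φ v = A.eval v / B.eval v)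
    (hd : ∀ v, K.eval v ≠ 0 → HasDerivAt Φ (Φ' v) v) (hd0 : ∀ v, K.eval v ≠ 0 → Φ' v ≠ 0)
    (hint : ∀ v, K.eval v ≠ 0 → Φ' v * R.eval (RingHom.id ℂ) v = α + κ * Φ v) :
    IsFinitelyValued U u := by
  have hnhds : ∀ v, K.eval v ≠ 0 → ∀ᶠ x in 𝓝 v, K.eval x ≠ 0 := fun v hv =>
    K.continuous.continuousAt.eventually_ne hv
  by_cases hall : ∀ z ∈ U, K.eval (u z) = 0
  · -- the relation `K(u) = 0` itself leaves only finitely many values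
    obtain ⟨z₁, hz₁⟩ := hu.isConnected.nonempty
    exact hu.isFinitelyValued_of_polynomial_relation (A := K) (B := 0) (w := fun _ => 0)
      (by fun_prop) (by simpa using hK) hz₁
      (Filter.eventually_of_mem (hu.isOpen.mem_nhds hz₁) (by simpa using hall))
  · push Not at hall
    obtain ⟨z₁, hz₁, hKz₁⟩ := hall
    have huK : ∀ᶠ x in 𝓝 z₁, K.eval (u x) ≠ 0 :=
      (hu.hasDerivAt z₁ hz₁).continuousAt.eventually (hnhds _ hKz₁)
    have hy : ∀ᶠ x in 𝓝 z₁, HasDerivAt (fun x => Φ (u x)) (α + κ * Φ (u x)) x := by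
      filter_upwards [huK, hu.isOpen.mem_nhds hz₁] with x h1 h2
      exact ((hd _ h1).comp x (hu.hasDerivAt x h2)).congr_deriv (hint _ h1)
    obtain ⟨w, hw, hwy⟩ := exists_entire_of_linear_ode hy
    refine hu.isFinitelyValued_of_polynomial_relation hw (fun z h0 => ?_) hz₁ (A := A) (B := B) ?_
    · have hconst : ∀ v, K.eval v ≠ 0 → Φ v = w z := by
        intro v hv
        rw [hΦ v hv, sub_eq_zero.1 h0, Polynomial.eval_mul, Polynomial.eval_C,
          mul_div_cancel_right₀ _ (hB v hv)]
      have h1 : HasDerivAt Φ 0 (u z₁) :=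
        (hasDerivAt_const (u z₁) (w z)).congr_of_eventuallyEq
          ((hnhds _ hKz₁).mono fun v hv => hconst v hv)
      exact hd0 _ hKz₁ ((hd _ hKz₁).unique h1)
    · filter_upwards [huK, hwy] with x h1 h2
      rw [← h2, hΦ _ h1, div_mul_cancel₀ _ (hB _ h1), sub_self]

theorem RatFunc.IsEval.eval_denom_ne_zero {v y : ℂ} {f : RatFunc ℂ} (h : RatFunc.IsEval v f y) :
    f.denom.eval v ≠ 0 := by
  obtain ⟨a, b, hb, hf, -⟩ := h
  intro h0
  have hb0 : b ≠ 0 := by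
    rintro rfl
    simp at hb
  exact hb (Polynomial.eval_eq_zero_of_dvd_of_eval_eq_zero
    ((RatFunc.denom_dvd hb0).2 ⟨a, hf⟩) h0)

theorem RatFunc.IsEval.eq_num_div_denom {v y : ℂ} {f : RatFunc ℂ} (h : RatFunc.IsEval v f y) :
    y = f.num.eval v / f.denom.eval v :=
  h.unique ⟨_, _, h.eval_denom_ne_zero, (RatFunc.num_div_denom f).symm, rfl⟩

/-- If `1 / R` has no residues, then it has a rational primitive, which grows linearly along
solutions. -/
theorem isFinitelyValued_of_ratResidue_eq_zero (hR : R ≠ 0)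
    (hres : ∀ a : ℂ, R.num.eval a = 0 → ratResidue R⁻¹ a = 0) {U : Set ℂ} {u : ℂ → ℂ}
    (hu : IsRatODESolution R U u) : IsFinitelyValued U u := by
  obtain ⟨p, Q, hpf⟩ := RatFunc.hasPartialFractions R⁻¹
  have hQ : ∀ a, (Q a).coeff 0 = 0 := by
    intro a
    rw [← ratResidue_partialFractionSum p Q a, ← hpf]
    by_cases ha : R.num.eval a = 0
    · exact hres a ha
    · exact ratResidue_eq_zero_of_isEval (RatFunc.IsEval.inv_of_num_ne_zero ha)
  obtain ⟨P, hP⟩ := Polynomial.exists_derivative_eq p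
  choose L hL using fun a => Polynomial.exists_derivative_eq (-(Q a).divX)
  set F : RatFunc ℂ := algebraMap (Polynomial ℂ) (RatFunc ℂ) P + ∑ a ∈ Q.support,
    Polynomial.aeval (RatFunc.X - RatFunc.C a)⁻¹ (L a)
  set Φ : ℂ → ℂ := fun v => P.eval v + ∑ a ∈ Q.support, (L a).eval (v - a)⁻¹ with hΦ
  set K : Polynomial ℂ := R.num * R.denom * ∏ a ∈ Q.support, (Polynomial.X - Polynomial.C a)
  have hK : ∀ v, K.eval v ≠ 0 → R.IsRegularValue v ∧ ∀ a ∈ Q.support, v - a ≠ 0 := by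
    intro v hv
    simp only [K, Polynomial.eval_mul, Polynomial.eval_prod, Polynomial.eval_sub, Polynomial.eval_X,
      Polynomial.eval_C, mul_ne_zero_iff, Finset.prod_ne_zero_iff] at hv
    exact hv
  have hF : ∀ v, K.eval v ≠ 0 → RatFunc.IsEval v F (Φ v) := by
    intro v hv
    refine (RatFunc.IsEval.of_polynomial P).add (RatFunc.IsEval.sum _ fun a ha => ?_)
    exact (RatFunc.IsEval.inv_X_sub_C (sub_ne_zero.1 ((hK v hv).2 a ha))).aeval _
  refine hu.isFinitelyValued_of_integral (K := K) (A := F.num) (B := F.denom) (Φ := Φ)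
    (Φ' := R.recip) (α := 1) (κ := 0) ?_ (fun v hv => (hF v hv).eval_denom_ne_zero)
    (fun v hv => (hF v hv).eq_num_div_denom) (fun v hv => ?_)
    (fun v hv => (hK v hv).1.recip_ne_zero) (fun v hv => ?_)
  · refine mul_ne_zero (mul_ne_zero (RatFunc.num_ne_zero hR) R.denom_ne_zero) ?_
    exact Finset.prod_ne_zero_iff.2 fun a _ => Polynomial.X_sub_C_ne_zero a
  · obtain ⟨hreg, hne⟩ := hK v hv
    rw [RatFunc.recip_eq_of_partialFractions hpf hreg.1 fun h => hne v h (sub_self v), ← hP]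
    refine (P.hasDerivAt v).fun_add (HasDerivAt.fun_sum fun a ha => ?_)
    have hva := hne a ha
    have hinv : HasDerivAt (fun v => (v - a)⁻¹) (-1 / (v - a) ^ 2) v :=
      ((hasDerivAt_id v).sub_const a).fun_inv hva
    refine (((L a).hasDerivAt (v - a)⁻¹).comp v hinv).congr_deriv ?_
    conv_rhs => rw [← Polynomial.divX_mul_X_add (Q a), hQ a]
    rw [hL]
    simp only [Polynomial.eval_add, Polynomial.eval_mul, Polynomial.eval_X, Polynomial.eval_C,
      Polynomial.eval_neg]
    field_simp
    ring
  · rw [(hK v hv).1.recip_mul_eval, zero_mul, add_zero]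

/-- If `1 / R` is a constant multiple of a sum of simple fractions with rational coefficients, then
the exponential of a constant multiple of its primitive is rational, and it grows exponentially
along solutions. -/
theorem isFinitelyValued_of_rational_residues (hR : R ≠ 0) {n : ℕ} {ξ : ℂ} {a : Fin n → ℂ}
    {β : Fin n → ℚ} (hξ : ξ ≠ 0)
    (hpf : R⁻¹ = RatFunc.C ξ * ∑ j, RatFunc.C (β j : ℂ) / (RatFunc.X - RatFunc.C (a j)))
    {U : Set ℂ} {u : ℂ → ℂ} (hu : IsRatODESolution R U u) : IsFinitelyValued U u := by
  obtain ⟨d, hd, m, hm⟩ : ∃ d : ℕ, d ≠ 0 ∧ ∃ m : Fin n → ℤ, ∀ j, (d : ℂ) * (β j : ℂ) = m j := by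
    refine ⟨∏ j, (β j).den, Finset.prod_ne_zero_iff.2 fun j _ => (β j).den_nz,
      fun j => (β j).num * ∏ i ∈ Finset.univ.erase j, ((β i).den : ℤ), fun j => ?_⟩
    rw [← Finset.mul_prod_erase _ _ (Finset.mem_univ j)]
    have h1 : ((β j).den : ℂ) * (β j : ℂ) = (β j).num := by
      have := Rat.den_mul_eq_num (β j)
      exact_mod_cast congrArg (fun x : ℚ => (x : ℂ)) this
    push_cast
    rw [← h1]
    ring
  have hdC : (d : ℂ) ≠ 0 := by exact_mod_cast hd
  set Φ : ℂ → ℂ := fun v => ∏ j, (v - a j) ^ m j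
  set K : Polynomial ℂ := R.num * R.denom * ∏ j, (Polynomial.X - Polynomial.C (a j))
  have hK : ∀ v, K.eval v ≠ 0 → R.IsRegularValue v ∧ ∀ j, v - a j ≠ 0 := by
    intro v hv
    simp only [K, Polynomial.eval_mul, Polynomial.eval_prod, Polynomial.eval_sub, Polynomial.eval_X,
      Polynomial.eval_C, mul_ne_zero_iff, Finset.prod_ne_zero_iff] at hv
    exact ⟨hv.1, fun j => hv.2 j (Finset.mem_univ j)⟩
  have hrecip : ∀ v, K.eval v ≠ 0 → R.recip v = ξ * ∑ j, (β j : ℂ) * (v - a j)⁻¹ := by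
    intro v hv
    refine (RatFunc.IsEval.inv_of_num_ne_zero (hK v hv).1.1).unique ?_
    rw [hpf]
    refine (RatFunc.IsEval.C ξ).mul (RatFunc.IsEval.sum _ fun j _ => ?_)
    rw [div_eq_mul_inv]
    exact (RatFunc.IsEval.C _).mul (RatFunc.IsEval.inv_X_sub_C (sub_ne_zero.1 ((hK v hv).2 j)))
  have hΦ0 : ∀ v, K.eval v ≠ 0 → Φ v ≠ 0 := fun v hv =>
    Finset.prod_ne_zero_iff.2 fun j _ => zpow_ne_zero _ ((hK v hv).2 j)
  refine hu.isFinitelyValued_of_integral (K := K)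
    (A := ∏ j, (Polynomial.X - Polynomial.C (a j)) ^ (m j).toNat)
    (B := ∏ j, (Polynomial.X - Polynomial.C (a j)) ^ (-m j).toNat) (Φ := Φ)
    (Φ' := fun v => d / ξ * R.recip v * Φ v) (α := 0) (κ := d / ξ) ?_ (fun v hv => ?_)
    (fun v hv => ?_) (fun v hv => ?_) (fun v hv => ?_) (fun v hv => ?_)
  · refine mul_ne_zero (mul_ne_zero (RatFunc.num_ne_zero hR) R.denom_ne_zero) ?_
    exact Finset.prod_ne_zero_iff.2 fun j _ => Polynomial.X_sub_C_ne_zero (a j)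
  · rw [Polynomial.eval_prod, Finset.prod_ne_zero_iff]
    intro j _
    rw [Polynomial.eval_pow, Polynomial.eval_sub, Polynomial.eval_X, Polynomial.eval_C]
    exact pow_ne_zero _ ((hK v hv).2 j)
  · rw [Polynomial.eval_prod, Polynomial.eval_prod, ← Finset.prod_div_distrib]
    refine Finset.prod_congr rfl fun j _ => ?_
    simp only [Polynomial.eval_pow, Polynomial.eval_sub, Polynomial.eval_X, Polynomial.eval_C]
    rw [← zpow_natCast, ← zpow_natCast, ← zpow_sub₀ ((hK v hv).2 j)]
    congr 1
    omega
  · have h1 : HasDerivAt Φ (∑ j, (∏ i ∈ Finset.univ.erase j, (v - a i) ^ m i) •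
        (m j * (v - a j) ^ (m j - 1))) v := by
      refine HasDerivAt.fun_finsetProd fun j _ => ?_
      exact ((hasDerivAt_zpow (m j) (v - a j) (Or.inl ((hK v hv).2 j))).comp v
        ((hasDerivAt_id v).sub_const (a j))).congr_deriv (mul_one _)
    refine h1.congr_deriv ?_
    rw [hrecip v hv, ← mul_assoc, div_mul_cancel₀ _ hξ, Finset.mul_sum, Finset.sum_mul]
    refine Finset.sum_congr rfl fun j _ => ?_
    have hprod : Φ v = (∏ i ∈ Finset.univ.erase j, (v - a i) ^ m i) * (v - a j) ^ m j :=
      (Finset.prod_erase_mul _ _ (Finset.mem_univ j)).symm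
    rw [← mul_assoc, hm, smul_eq_mul, zpow_sub_one₀ ((hK v hv).2 j), hprod]
    ring
  · exact mul_ne_zero (mul_ne_zero (div_ne_zero hdC hξ) (hK v hv).1.recip_ne_zero) (hΦ0 v hv)
  · rw [zero_add]
    linear_combination (d / ξ * Φ v) * (hK v hv).1.recip_mul_eval

theorem isFinitelyValued_of_eq_zero {U : Set ℂ} {u : ℂ → ℂ} (hu : IsRatODESolution 0 U u) :
    IsFinitelyValued U u := by
  obtain ⟨z₁, hz₁⟩ := hu.isConnected.nonempty
  refine hu.isFinitelyValued_of_polynomial_relation (A := Polynomial.X) (B := 1)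
    (w := fun _ => u z₁) (by fun_prop)
    (fun _ => by simpa using Polynomial.X_sub_C_ne_zero (u z₁)) hz₁ ?_
  have h : ∀ᶠ x in 𝓝 z₁, HasDerivAt u 0 x :=
    Filter.eventually_of_mem (hu.isOpen.mem_nhds hz₁) fun x hx => by
      simpa using hu.hasDerivAt x hx
  filter_upwards [eventually_eq_of_hasDerivAt_zero h] with x hx
  simp [hx]

theorem mainTheorem3 (R : RatFunc ℂ) :
    (∀ (U : Set ℂ) (u : ℂ → ℂ), IsRatODESolution R U u → IsFinitelyValued U u) ↔
      (R = 0 ∨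
        (∀ a : ℂ, R.num.eval a = 0 → ratResidue R⁻¹ a = 0) ∨
        ∃ n : ℕ, 0 < n ∧ ∃ (ξ : ℂ) (a : Fin n → ℂ) (β : Fin n → ℚ), ξ ≠ 0 ∧
          R⁻¹ = RatFunc.C ξ * ∑ j, RatFunc.C (β j : ℂ) / (RatFunc.X - RatFunc.C (a j))) := by
  constructor
  · intro hfin
    by_contra! hcon
    obtain ⟨hR, ⟨a, -, ha⟩, hno⟩ := hcon
    obtain ⟨n, hn, ξ, b, β, hξ, h⟩ := exists_rational_residues hfin hR ha
    exact hno n hn ξ b β hξ h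
  · intro h U u hu
    by_cases hR : R = 0
    · subst hR
      exact isFinitelyValued_of_eq_zero hu
    · rcases h with h | h | ⟨n, -, ξ, a, β, hξ, h⟩
      · exact absurd h hR
      · exact isFinitelyValued_of_ratResidue_eq_zero hR h hu
      · exact isFinitelyValued_of_rational_residues hR hξ h hu
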